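/- Let $N\ge 1$, $0<s<1<p$ with $sp<N$. For measurable $u:\mathbb R^N\to\mathbb R$ put $$\|u\|_{s,p}^p=\int_{\mathbb R^N\times\mathbb R^N}\frac{|u(x)-u(y)|^p}{|x-y|^{N+sp}}\,dx\,dy,$$ and let $\mathcal D^{s,p}(\mathbb R^N)$ be the completion of $C_c^1(\mathbb R^N)$ with respect to $\|\cdot\|_{s,p}$, regarded as a space of functions (limits, in $\|\cdot\|_{s,p}$ and almost everywhere, of sequences in $C_c^1(\mathbb R^N)$). For a measurable relatively compact set $F\subset\mathbb R^N$ let $\mathrm{Cap}_{s,p}(F)=\inf\{\|u\|_{s,p}^p: u\in\mathcal D^{s,p}(\mathbb R^N),\ u\ge 1\text{ a.e. in }F\}$. Let $\mathcal H_{s,p}(\mathbb R^N)$ be the set of $w\in L^1_{loc}(\mathbb R^N)$ for which there is $C>0$ with $\int_{\mathbb R^N}|w||u|^p\,dx\le C\|u\|_{s,p}^p$ for all $u\in\mathcal D^{s,p}(\mathbb R^N)$, with the norm $\|w\|=\sup_F \big(\int_F|w|\,dx\big)/\mathrm{Cap}_{s,p}(F)$ (supremum over measurable relatively compact $F$, with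 $0/0=0$), and let $\mathcal H_{s,p,0}(\mathbb R^N)$ be the closure of $C_c(\mathbb R^N)$ in it. Let $w=w_1-w_2$ with $w_1,w_2\ge 0$ a.e., $w_1\in\mathcal H_{s,p,0}(\mathbb R^N)$ and $w_2\in L^1_{loc}(\mathbb R^N)$. A real number $\lambda$ is an eigenvalue of $(-\Delta_p)^su=\lambda w|u|^{p-2}u$ in $\mathbb R^N$, with eigenfunction $u$, if $u\in\mathcal D^{s,p}(\mathbb R^N)$, $u\not\equiv 0$, and for every $v\in\mathcal D^{s,p}(\mathbb R^N)$ the function $w|u|^{p-2}uv$ is integrable and $$\int_{\mathbb R^N\times\mathbb R^N}\frac{|u(x)-u(y)|^{p-2}(u(x)-u(y))(v(x)-v(y))}{|x-y|^{N+sp}}\,dx\,dy=\lambda\int_{\mathbb R^N}w|u|^{p-2}uv\,dx .$$ Let $$\lambda_1=\inf\Big\{\|u\|_{s,p}^p: u\in\mathcal D^{s,p}(\mathbb R^N),\ w|u|^p\in L^1(\mathbb R^N),\ \int_{\mathbb R^N}w|u|^p\,dx=1\Big\}.$$ Then every eigenfunction $u$ belonging to an eigenvalue $\lambda\ge 0$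 with $\lambda\ne\lambda_1$ changes sign, that is, both $\{u>0\}$ and $\{u<0\}$ have positive Lebesgue measure. (If no admissible $u$ exists in the definition of $\lambda_1$, the conclusion holds for every eigenvalue $\lambda\ge 0$ under either convention $\lambda_1=0$ or $\lambda_1=+\infty$, because there are then no such eigenvalues.) -/

import Mathlib

open MeasureTheory Filter Topology
open scoped ENNReal NNReal

namespace FracHardy

/-- The space `ℝ^N` with its Euclidean norm and Lebesgue measure. -/
abbrev RN (N : ℕ) : Type := EuclideanSpace ℝ (Fin N)

/-- The `p`-th power `‖u‖_{s,p}^p` of the Gagliardo seminorm, as an extended nonnegative number: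
the integral of `|u x - u y| ^ p / |x - y| ^ (N + s p)` over `ℝ^N × ℝ^N`. -/
noncomputable def energy {N : ℕ} (s p : ℝ) (u : RN N → ℝ) : ℝ≥0∞ :=
  ∫⁻ z : RN N × RN N,
    ENNReal.ofReal (|u z.1 - u z.2| ^ p / ‖z.1 - z.2‖ ^ ((N : ℝ) + s * p))

/-- Membership in `𝓓^{s,p}(ℝ^N)`, the completion of `C_c^1(ℝ^N)` for `‖·‖_{s,p}`, realized as a
space of (a.e. classes of) functions: `u` is the limit, both in `‖·‖_{s,p}` and almost everywhere,
of a sequence in `C_c^1(ℝ^N)`. (The seminorm alone does not see additive constants; the a.e.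
convergence fixes the representative of the limit.) -/
def MemD {N : ℕ} (s p : ℝ) (u : RN N → ℝ) : Prop :=
  ∃ φ : ℕ → RN N → ℝ,
    (∀ n, ContDiff ℝ 1 (φ n) ∧ HasCompactSupport (φ n)) ∧
    Tendsto (fun n => energy s p (fun x => φ n x - u x)) atTop (𝓝 0) ∧
    ∀ᵐ x, Tendsto (fun n => φ n x) atTop (𝓝 (u x))

/-- The `(s,p)`-capacity of a set `F` relative to `ℝ^N`. -/
noncomputable def cap {N : ℕ} (s p : ℝ) (F : Set (RN N)) : ℝ≥0∞ :=
  ⨅ u ∈ {u : RN N → ℝ | MemD s p u ∧ ∀ᵐ x ∂(volume.restrict F), 1 ≤ u x}, energy s p u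

/-- The norm of the space of `(s,p)`-Hardy potentials: the supremum of `(∫_F |w|) / Cap_{s,p}(F)`
over measurable relatively compact sets `F` (with `0 / 0 = 0`, as for null sets `F`). -/
noncomputable def hardyNorm {N : ℕ} (s p : ℝ) (w : RN N → ℝ) : ℝ≥0∞ :=
  ⨆ F ∈ {F : Set (RN N) | MeasurableSet F ∧ IsCompact (closure F)},
    (∫⁻ x in F, ENNReal.ofReal |w x|) / cap s p F

/-- `(s,p)`-Hardy potentials: locally integrable weights satisfying the fractional Hardy
inequality with some constant. -/
def MemHardy {N : ℕ} (s p : ℝ) (w : RN N → ℝ) : Prop :=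
  LocallyIntegrable w ∧
    ∃ C : ℝ≥0, ∀ u : RN N → ℝ, MemD s p u →
      ∫⁻ x, ENNReal.ofReal (|w x| * |u x| ^ p) ≤ (C : ℝ≥0∞) * energy s p u

/-- The closure of `C_c(ℝ^N)` in the space of `(s,p)`-Hardy potentials. -/
def MemHardyZero {N : ℕ} (s p : ℝ) (w : RN N → ℝ) : Prop :=
  MemHardy s p w ∧
    ∀ ε : ℝ≥0∞, 0 < ε → ∃ g : RN N → ℝ, Continuous g ∧ HasCompactSupport g ∧
      hardyNorm s p (fun x => w x - g x) < ε

/-- The weak form of the fractional `p`-Laplacian, tested with `v`. -/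
noncomputable def weakForm {N : ℕ} (s p : ℝ) (u v : RN N → ℝ) : ℝ :=
  ∫ z : RN N × RN N,
    |u z.1 - u z.2| ^ (p - 2) * (u z.1 - u z.2) * (v z.1 - v z.2) /
      ‖z.1 - z.2‖ ^ ((N : ℝ) + s * p)

/-- `u` is an eigenfunction, belonging to the eigenvalue `lam`, of
`(-Δ_p)^s u = lam * w * |u|^(p-2) * u` in `ℝ^N`: a nonzero element of `𝓓^{s,p}(ℝ^N)` satisfying the
weak equation (whose right-hand side is in particular meaningful) for every test function in
`𝓓^{s,p}(ℝ^N)`. -/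
def IsEigenfunction {N : ℕ} (s p : ℝ) (w : RN N → ℝ) (lam : ℝ) (u : RN N → ℝ) : Prop :=
  MemD s p u ∧ ¬ (∀ᵐ x, u x = 0) ∧
    ∀ v : RN N → ℝ, MemD s p v →
      Integrable (fun x => w x * |u x| ^ (p - 2) * u x * v x) ∧
      weakForm s p u v = lam * ∫ x, w x * |u x| ^ (p - 2) * u x * v x

/-- The first eigenvalue: the infimum of `‖u‖_{s,p}^p` over all `u ∈ 𝓓^{s,p}(ℝ^N)` such that
`w |u|^p` is integrable with integral `1`. -/
noncomputable def firstEigenvalue {N : ℕ} (s p : ℝ) (w : RN N → ℝ) : ℝ :=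
  sInf {t : ℝ | ∃ u : RN N → ℝ, MemD s p u ∧ Integrable (fun x => w x * |u x| ^ p) ∧
    ∫ x, w x * |u x| ^ p = 1 ∧ t = (energy s p u).toReal}

/-- `u` changes sign: it is positive on a set of positive measure and negative on a set of
positive measure. -/
def ChangesSign {N : ℕ} (u : RN N → ℝ) : Prop :=
  0 < volume {x | 0 < u x} ∧ 0 < volume {x | u x < 0}

end FracHardy

/-!
Everything rests on Picone's inequality: for `u ≥ 0`, testing the fractional `p`-Laplacian of `u`
with `|v| ^ p / u ^ (p - 1)` gives at most `‖v‖_{s,p}^p`. To obtain an admissible test function one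
replaces `|v|` by `min |v| k` and `u` by `u + ε`; the result is a Lipschitz function of `(u, v)`,
and such functions operate on `𝓓^{s,p}`.

Let `u` be a nonnegative eigenfunction. Multiplied by `ε ^ (p - 1)` and in the limit `ε → 0`, the
inequality forces `v` to vanish almost everywhere on `{u = 0}`, for every `v`: hence `u > 0`. Then
`k → ∞`, `ε → 0` in the inequality itself gives `λ ∫ w |v| ^ p ≤ ‖v‖_{s,p}^p` for every admissible
`v`, with equality for `v = u`. As `λ ∫ w |u| ^ p = ‖u‖_{s,p}^p > 0`, a multiple of `u` attains the
infimum defining the first eigenvalue, which is therefore `λ`. The positivity of `‖u‖_{s,p}` is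
where `s * p < N` enters: elements of `𝓓^{s,p}` are controlled in `L^1_loc` by their seminorm.
-/

namespace FracHardy

/-! ### The Gagliardo measure -/

/-- The measure `|x - y|^{-(N + sp)} dx dy` on `ℝ^N × ℝ^N`: the Gagliardo seminorm of `u` is the
`L^p` norm, for this measure, of `(x, y) ↦ u x - u y`. The junk value `0⁻¹ = 0` makes its density
vanish on the diagonal. -/
noncomputable def gagliardoMeasure (N : ℕ) (s p : ℝ) : Measure (RN N × RN N) :=
  volume.withDensity fun z => ENNReal.ofReal (‖z.1 - z.2‖ ^ ((N : ℝ) + s * p))⁻¹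

/-- The increments `u x - u y` of `u`, as a function of the pair `(x, y)`. -/
def increment {E : Type*} (u : E → ℝ) (z : E × E) : ℝ := u z.1 - u z.2

variable {N : ℕ} {s p lam : ℝ} {u v w : RN N → ℝ}

lemma measurable_gagliardoDensity :
    Measurable fun z : RN N × RN N => ENNReal.ofReal (‖z.1 - z.2‖ ^ ((N : ℝ) + s * p))⁻¹ := by
  fun_prop

lemma energy_eq_lintegral_enorm_rpow (hp : 0 ≤ p) (u : RN N → ℝ) :
    energy s p u = ∫⁻ z, ‖increment u z‖ₑ ^ p ∂gagliardoMeasure N s p := by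
  rw [gagliardoMeasure, lintegral_withDensity_eq_lintegral_mul_non_measurable _
    measurable_gagliardoDensity (.of_forall fun _ => ENNReal.ofReal_lt_top)]
  refine lintegral_congr fun z => ?_
  rw [Pi.mul_apply, ← ofReal_norm, ENNReal.ofReal_rpow_of_nonneg (norm_nonneg _) hp,
    ← ENNReal.ofReal_mul (by positivity), div_eq_inv_mul]
  rfl

lemma energy_eq_eLpNorm_rpow (hp : 0 < p) (u : RN N → ℝ) :
    energy s p u = eLpNorm (increment u) (ENNReal.ofReal p) (gagliardoMeasure N s p) ^ p := by
  rw [energy_eq_lintegral_enorm_rpow hp.le, eLpNorm_eq_lintegral_rpow_enorm_toReal (by simpa)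
    ENNReal.ofReal_ne_top, ENNReal.toReal_ofReal hp.le, one_div, ENNReal.rpow_inv_rpow hp.ne']

/-- The integrand of the weak form of the fractional `p`-Laplacian, as a density with respect to
`gagliardoMeasure`. -/
noncomputable def weakIntegrand {E : Type*} (p : ℝ) (u v : E → ℝ) (z : E × E) : ℝ :=
  |increment u z| ^ (p - 2) * increment u z * increment v z

lemma weakForm_eq_integral (u v : RN N → ℝ) :
    weakForm s p u v = ∫ z, weakIntegrand p u v z ∂gagliardoMeasure N s p := by
  rw [gagliardoMeasure, integral_withDensity_eq_integral_toReal_smul measurable_gagliardoDensity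
    (.of_forall fun _ => ENNReal.ofReal_lt_top)]
  refine integral_congr_ae (.of_forall fun z => ?_)
  dsimp only
  rw [ENNReal.toReal_ofReal (by positivity), smul_eq_mul, ← div_eq_inv_mul]
  rfl

lemma ae_gagliardoMeasure_of_ae {P : RN N → Prop} (h : ∀ᵐ x, P x) :
    ∀ᵐ z ∂gagliardoMeasure N s p, P z.1 ∧ P z.2 :=
  withDensity_absolutelyContinuous _ _ <|
    (Measure.quasiMeasurePreserving_fst.ae h).and (Measure.quasiMeasurePreserving_snd.ae h)

lemma ae_prod_of_ae_gagliardoMeasure {P : RN N × RN N → Prop}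
    (h : ∀ᵐ z ∂gagliardoMeasure N s p, P z) : ∀ᵐ z : RN N × RN N, z.1 ≠ z.2 → P z := by
  filter_upwards [(ae_withDensity_iff measurable_gagliardoDensity).1 h] with z hz hne
  have : 0 < ‖z.1 - z.2‖ := norm_sub_pos_iff.2 hne
  exact hz (ENNReal.ofReal_pos.2 (by positivity)).ne'

lemma aestronglyMeasurable_increment (hu : AEMeasurable u) :
    AEStronglyMeasurable (increment u) (gagliardoMeasure N s p) :=
  have h := (hu.comp_quasiMeasurePreserving Measure.quasiMeasurePreserving_fst).sub
    (hu.comp_quasiMeasurePreserving Measure.quasiMeasurePreserving_snd)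
  h.aestronglyMeasurable.mono_ac (withDensity_absolutelyContinuous _ _)

lemma memLp_increment_iff (hp : 0 < p) (hu : AEMeasurable u) :
    MemLp (increment u) (ENNReal.ofReal p) (gagliardoMeasure N s p) ↔ energy s p u ≠ ⊤ := by
  rw [energy_eq_eLpNorm_rpow hp, ne_eq, ENNReal.rpow_eq_top_iff_of_pos hp, ← ne_eq,
    ← lt_top_iff_ne_top]
  exact ⟨fun h => h.2, fun h => ⟨aestronglyMeasurable_increment hu, h⟩⟩

lemma tendsto_energy_zero_iff (hp : 0 < p) {ι : Type*} {l : Filter ι} {f : ι → RN N → ℝ} :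
    Tendsto (fun i => energy s p (f i)) l (𝓝 0) ↔ Tendsto (fun i =>
      eLpNorm (increment (f i)) (ENNReal.ofReal p) (gagliardoMeasure N s p)) l (𝓝 0) := by
  simp only [energy_eq_eLpNorm_rpow hp]
  refine ⟨fun h => ?_, fun h => ?_⟩
  · simpa [ENNReal.rpow_rpow_inv hp.ne', hp] using h.ennrpow_const p⁻¹
  · simpa [hp] using h.ennrpow_const p

section RadialKernel

variable {a L M : ℝ}

lemma integrableOn_min_mul_rpow_mul_rpow (ha : 0 < a) (hap : a < p) (hL : 0 ≤ L) (hM : 0 ≤ M) :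
    IntegrableOn (fun t : ℝ => min (L * t) M ^ p * t ^ (-1 - a)) (Set.Ioi 0) := by
  have hp : 0 ≤ p := (ha.trans hap).le
  have hmeas : Measurable fun t : ℝ => min (L * t) M ^ p * t ^ (-1 - a) := by fun_prop
  have near_zero : IntegrableOn (fun t : ℝ => L ^ p * t ^ (p - a - 1)) (Set.Ioc 0 1) :=
    ((intervalIntegrable_iff_integrableOn_Ioc_of_le zero_le_one).1
      (intervalIntegral.intervalIntegrable_rpow' (by linarith))).const_mul _
  have near_infty : IntegrableOn (fun t : ℝ => M ^ p * t ^ (-1 - a)) (Set.Ioi 1) :=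
    (integrableOn_Ioi_rpow_of_lt (by linarith) one_pos).const_mul _
  rw [← Set.Ioc_union_Ioi_eq_Ioi zero_le_one]
  refine IntegrableOn.union (near_zero.mono' hmeas.aestronglyMeasurable ?_)
    (near_infty.mono' hmeas.aestronglyMeasurable ?_)
  · filter_upwards [ae_restrict_mem measurableSet_Ioc] with t ht
    have ht : 0 < t := ht.1
    have : 0 ≤ min (L * t) M := le_min (by positivity) hM
    calc ‖min (L * t) M ^ p * t ^ (-1 - a)‖ = min (L * t) M ^ p * t ^ (-1 - a) :=
          Real.norm_of_nonneg (by positivity)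
      _ ≤ (L * t) ^ p * t ^ (-1 - a) := by gcongr; exact min_le_left _ _
      _ = L ^ p * t ^ (p - a - 1) := by
          rw [Real.mul_rpow hL ht.le, mul_assoc, ← Real.rpow_add ht]; ring_nf
  · filter_upwards [ae_restrict_mem measurableSet_Ioi] with t ht
    have ht : 0 < t := one_pos.trans ht
    have : 0 ≤ min (L * t) M := le_min (by positivity) hM
    rw [Real.norm_of_nonneg (by positivity)]
    gcongr
    exact min_le_right _ _

lemma integrable_min_mul_norm_rpow_div {E : Type*} [NormedAddCommGroup E] [NormedSpace ℝ E]
    [FiniteDimensional ℝ E] [MeasurableSpace E] [BorelSpace E] (μ : Measure E) [μ.IsAddHaarMeasure]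
    (ha : 0 < a) (hap : a < p) (hL : 0 ≤ L) (hM : 0 ≤ M) :
    Integrable (fun x : E => min (L * ‖x‖) M ^ p / ‖x‖ ^ (Module.finrank ℝ E + a)) μ := by
  rcases subsingleton_or_nontrivial E with _ | _
  · exact .of_finite
  refine (integrable_fun_norm_addHaar μ
    (f := fun t => min (L * t) M ^ p / t ^ (Module.finrank ℝ E + a))).2 ?_
  refine (integrableOn_min_mul_rpow_mul_rpow ha hap hL hM).congr_fun (fun t ht => ?_)
    measurableSet_Ioi
  have ht : 0 < t := ht
  rw [smul_eq_mul, mul_div_left_comm, ← Real.rpow_natCast, ← Real.rpow_sub ht,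
    Nat.cast_sub Module.finrank_pos, Nat.cast_one]
  ring_nf

end RadialKernel

lemma integrable_mul_comp_sub {G : Type*} [AddGroup G] [MeasurableSpace G] [MeasurableAdd₂ G]
    [MeasurableNeg G] {μ : Measure G} [SFinite μ] [μ.IsAddRightInvariant] {f g : G → ℝ}
    (hf : Integrable f μ) (hg : Integrable g μ) :
    Integrable (fun z : G × G => f z.1 * g (z.2 - z.1)) (μ.prod μ) :=
  (measurePreserving_prod_sub μ μ).integrable_comp_of_integrable (hf.mul_prod hg)

lemma memLp_increment_of_lipschitzWith (hs0 : 0 < s) (hs1 : s < 1) (hp : 0 < p) {K : ℝ≥0}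
    {φ : RN N → ℝ} (hφ : LipschitzWith K φ) (hc : HasCompactSupport φ) :
    MemLp (increment φ) (ENNReal.ofReal p) (gagliardoMeasure N s p) := by
  rw [memLp_increment_iff hp hφ.continuous.aemeasurable]
  obtain ⟨M, hM⟩ := hφ.continuous.bounded_above_of_compact_support hc
  have hM0 : 0 ≤ M := (norm_nonneg _).trans (hM 0)
  set g : RN N → ℝ := fun x => min (K * ‖x‖) (2 * M) ^ p / ‖x‖ ^ ((N : ℝ) + s * p)
  have hg : Integrable g := by
    simpa only [g, finrank_euclideanSpace_fin] using integrable_min_mul_norm_rpow_div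
      (volume : Measure (RN N)) (mul_pos hs0 hp) (mul_lt_of_lt_one_left hp hs1)
      K.coe_nonneg (by positivity : 0 ≤ 2 * M)
  have g_nonneg (x) : 0 ≤ g x := by positivity
  have density_le (z : RN N × RN N) :
      |φ z.1 - φ z.2| ^ p / ‖z.1 - z.2‖ ^ ((N : ℝ) + s * p) ≤ g (z.2 - z.1) := by
    have hK : |φ z.1 - φ z.2| ≤ K * ‖z.1 - z.2‖ := by
      simpa only [dist_eq_norm, Real.norm_eq_abs] using hφ.dist_le_mul z.1 z.2
    have h2M : |φ z.1 - φ z.2| ≤ 2 * M := by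
      linarith [abs_sub (φ z.1) (φ z.2), hM z.1, hM z.2, Real.norm_eq_abs (φ z.1),
        Real.norm_eq_abs (φ z.2)]
    simp only [g, norm_sub_rev z.2]
    gcongr
    exact le_min hK h2M
  set F : RN N × RN N → ℝ := fun z => (tsupport φ).indicator 1 z.1 * g (z.2 - z.1)
  have hF : Integrable F := integrable_mul_comp_sub
    ((integrable_indicator_iff (isClosed_tsupport φ).measurableSet).2
      (integrableOn_const hc.measure_lt_top.ne)) hg
  have F_nonneg (z) : 0 ≤ F z := mul_nonneg (Set.indicator_nonneg (by simp) _) (g_nonneg _)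
  refine ne_top_of_le_ne_top (hF.add hF.swap).lintegral_lt_top.ne
    (lintegral_mono fun z => ENNReal.ofReal_le_ofReal ?_)
  change _ ≤ F z + F z.swap
  by_cases h₁ : z.1 ∈ tsupport φ
  · have : F z = g (z.2 - z.1) := by simp [F, h₁]
    linarith [density_le z, F_nonneg z.swap]
  by_cases h₂ : z.2 ∈ tsupport φ
  · have : F z.swap = g (z.2 - z.1) := by simp [F, g, h₂, norm_sub_rev z.1]
    linarith [density_le z, F_nonneg z]
  · rw [image_eq_zero_of_notMem_tsupport h₁, image_eq_zero_of_notMem_tsupport h₂, sub_self,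
      abs_zero, Real.zero_rpow hp.ne', zero_div]
    exact add_nonneg (F_nonneg _) (F_nonneg _)

lemma MemD.aemeasurable (hu : MemD s p u) : AEMeasurable u := by
  obtain ⟨φ, hφ, -, hlim⟩ := hu
  exact aemeasurable_of_tendsto_metrizable_ae' (fun n => (hφ n).1.continuous.aemeasurable) hlim

lemma memD_of_contDiff (hp : p ≠ 0) {φ : RN N → ℝ} (hφ : ContDiff ℝ 1 φ)
    (hc : HasCompactSupport φ) : MemD s p φ :=
  ⟨fun _ => φ, fun _ => ⟨hφ, hc⟩, by simp [energy, Real.zero_rpow hp], by simp⟩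

lemma memLp_increment_of_contDiff (hs0 : 0 < s) (hs1 : s < 1) (hp : 0 < p) {φ : RN N → ℝ}
    (hφ : ContDiff ℝ 1 φ) (hc : HasCompactSupport φ) :
    MemLp (increment φ) (ENNReal.ofReal p) (gagliardoMeasure N s p) :=
  let ⟨_, hK⟩ := ContDiff.lipschitzWith_of_hasCompactSupport hc hφ one_ne_zero
  memLp_increment_of_lipschitzWith hs0 hs1 hp hK hc

lemma MemD.memLp_increment (hs0 : 0 < s) (hs1 : s < 1) (hp : 0 < p) (hu : MemD s p u) :
    MemLp (increment u) (ENNReal.ofReal p) (gagliardoMeasure N s p) := by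
  have hum := hu.aemeasurable
  obtain ⟨φ, hφ, hE, -⟩ := hu
  obtain ⟨n, hn⟩ := (hE.eventually_ne ENNReal.zero_ne_top).exists
  have hsub := (memLp_increment_iff hp ((hφ n).1.continuous.aemeasurable.sub hum)).2 hn
  refine ((memLp_increment_of_contDiff hs0 hs1 hp (hφ n).1 (hφ n).2).sub hsub).ae_eq
    (.of_forall fun z => ?_)
  simp only [increment, Pi.sub_apply]
  ring

lemma MemD.energy_ne_top (hs0 : 0 < s) (hs1 : s < 1) (hp : 0 < p) (hu : MemD s p u) :
    energy s p u ≠ ⊤ :=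
  (memLp_increment_iff hp hu.aemeasurable).1 (hu.memLp_increment hs0 hs1 hp)

/-! ### Lipschitz functions operate on the energy space -/

section LipschitzApproximation

open scoped Convolution

variable {E : Type*} [NormedAddCommGroup E] [NormedSpace ℝ E] [FiniteDimensional ℝ E]
  [MeasurableSpace E] [BorelSpace E] {Φ : E → ℝ} {K : ℝ≥0}

lemma lipschitzWith_normed_convolution (ρ : ContDiffBump (0 : E)) (μ : Measure E)
    [μ.IsAddHaarMeasure] (hΦ : LipschitzWith K Φ) :
    LipschitzWith K (ρ.normed μ ⋆[ContinuousLinearMap.lsmul ℝ ℝ, μ] Φ) := by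
  have integrable_mul (x : E) : Integrable (fun t => ρ.normed μ t * Φ (x - t)) μ :=
    (ρ.continuous_normed.mul (hΦ.continuous.comp
      (continuous_const.sub continuous_id))).integrable_of_hasCompactSupport
      ρ.hasCompactSupport_normed.mul_right
  refine LipschitzWith.of_dist_le_mul fun x y => ?_
  calc dist (∫ t, ρ.normed μ t * Φ (x - t) ∂μ) (∫ t, ρ.normed μ t * Φ (y - t) ∂μ)
      = ‖∫ t, (ρ.normed μ t * Φ (x - t) - ρ.normed μ t * Φ (y - t)) ∂μ‖ := by
        rw [integral_sub (integrable_mul x) (integrable_mul y), dist_eq_norm]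
    _ ≤ ∫ t, ρ.normed μ t * (K * dist x y) ∂μ := by
        refine norm_integral_le_of_norm_le (ρ.integrable_normed.mul_const _)
          (.of_forall fun t => ?_)
        have hxy := hΦ.dist_le_mul (x - t) (y - t)
        rw [dist_sub_right, dist_eq_norm] at hxy
        rw [← mul_sub, norm_mul, Real.norm_of_nonneg (ρ.nonneg_normed t)]
        exact mul_le_mul_of_nonneg_left hxy (ρ.nonneg_normed t)
    _ = K * dist x y := by rw [integral_mul_const, ρ.integral_normed, one_mul]

lemma exists_contDiff_lipschitzWith_abs_sub_le (hΦ : LipschitzWith K Φ) {η : ℝ} (hη : 0 < η) :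
    ∃ Ψ : E → ℝ, ContDiff ℝ 1 Ψ ∧ LipschitzWith K Ψ ∧ ∀ x, |Ψ x - Φ x| ≤ η := by
  set μ : Measure E := Measure.addHaar
  set r : ℝ := η / (K + 1)
  have hr : 0 < r := by positivity
  let ρ : ContDiffBump (0 : E) := ⟨r / 2, r, by positivity, by linarith⟩
  refine ⟨_, ?_, lipschitzWith_normed_convolution ρ μ hΦ, fun x => ?_⟩
  · exact_mod_cast ρ.hasCompactSupport_normed.contDiff_convolution_left (n := 1)
      (ContinuousLinearMap.lsmul ℝ ℝ) ρ.contDiff_normed hΦ.continuous.locallyIntegrable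
  · rw [← Real.dist_eq]
    refine ContDiffBump.dist_normed_convolution_le hΦ.continuous.aestronglyMeasurable
      fun y hy => (hΦ.dist_le_mul y x).trans ?_
    calc K * dist y x ≤ (K + 1) * r := by
          gcongr
          · linarith
          · exact (Metric.mem_ball.1 hy).le
      _ = η := by simp only [r]; field_simp

lemma exists_contDiff_lipschitzWith_eq_zero_abs_sub_le (hΦ : LipschitzWith K Φ) (hΦ0 : Φ 0 = 0)
    {η : ℝ} (hη : 0 < η) :
    ∃ Ψ : E → ℝ, ContDiff ℝ 1 Ψ ∧ LipschitzWith K Ψ ∧ Ψ 0 = 0 ∧ ∀ x, |Ψ x - Φ x| ≤ η := by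
  obtain ⟨Ψ, hΨ, hΨK, hΨη⟩ := exists_contDiff_lipschitzWith_abs_sub_le hΦ (half_pos hη)
  refine ⟨fun x => Ψ x - Ψ 0, hΨ.sub contDiff_const, LipschitzWith.of_dist_le_mul fun x y => ?_,
    sub_self _, fun x => ?_⟩
  · rw [dist_sub_right]
    exact hΨK.dist_le_mul x y
  · calc |Ψ x - Ψ 0 - Φ x| = |(Ψ x - Φ x) - (Ψ 0 - Φ 0)| := by rw [hΦ0]; ring_nf
      _ ≤ |Ψ x - Φ x| + |Ψ 0 - Φ 0| := abs_sub _ _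
      _ ≤ η := by linarith [hΨη x, hΨη 0]

end LipschitzApproximation

section DominatedConvergence

variable {α F : Type*} [MeasurableSpace α] {μ : Measure α} [NormedAddCommGroup F]

lemma tendsto_eLpNorm_const_mul_add_zero {q : ℝ≥0∞} (hq1 : 1 ≤ q) {a b : ℕ → α → ℝ}
    (ha : ∀ n, AEStronglyMeasurable (a n) μ) (hb : ∀ n, AEStronglyMeasurable (b n) μ)
    (ha0 : Tendsto (fun n => eLpNorm (a n) q μ) atTop (𝓝 0))
    (hb0 : Tendsto (fun n => eLpNorm (b n) q μ) atTop (𝓝 0)) (c : ℝ) :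
    Tendsto (fun n => eLpNorm (fun x => c * (a n x + b n x)) q μ) atTop (𝓝 0) := by
  have h := ENNReal.Tendsto.const_mul (ha0.add hb0) (.inr (enorm_ne_top (x := c)))
  rw [add_zero, mul_zero] at h
  refine tendsto_of_tendsto_of_tendsto_of_le_of_le tendsto_const_nhds h (fun _ => zero_le)
    fun n => ?_
  calc eLpNorm (c • (a n + b n)) q μ = ‖c‖ₑ * eLpNorm (a n + b n) q μ := eLpNorm_const_smul ..
    _ ≤ ‖c‖ₑ * (eLpNorm (a n) q μ + eLpNorm (b n) q μ) := by
        gcongr; exact eLpNorm_add_le (ha n) (hb n) hq1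

lemma tendsto_eLpNorm_zero_of_dominated {q : ℝ≥0∞} (hq0 : q ≠ 0) (hq : q ≠ ⊤) {f : ℕ → α → F}
    {b : α → ℝ} (hf : ∀ n, AEStronglyMeasurable (f n) μ) (hb : MemLp b q μ)
    (hle : ∀ n, ∀ᵐ x ∂μ, ‖f n x‖ ≤ b x) (hlim : ∀ᵐ x ∂μ, Tendsto (f · x) atTop (𝓝 0)) :
    Tendsto (fun n => eLpNorm (f n) q μ) atTop (𝓝 0) := by
  have hq' : 0 < q.toReal := ENNReal.toReal_pos hq0 hq
  have h : Tendsto (fun n => ∫⁻ x, ‖f n x‖ₑ ^ q.toReal ∂μ) atTop (𝓝 (∫⁻ _, 0 ∂μ)) := by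
    refine tendsto_lintegral_of_dominated_convergence' (fun x => ‖b x‖ₑ ^ q.toReal)
      (fun n => (hf n).enorm.pow_const _)
      (fun n => ?_) (lintegral_rpow_enorm_lt_top_of_eLpNorm_lt_top hq0 hq hb.2).ne ?_
    · filter_upwards [hle n] with x hx
      gcongr
      exact enorm_le_iff_norm_le.2 (hx.trans (le_abs_self _))
    · filter_upwards [hlim] with x hx
      simpa [hq'] using (hx.enorm).ennrpow_const q.toReal
  simp only [eLpNorm_eq_lintegral_rpow_enorm_toReal hq0 hq]
  simpa [hq'] using h.ennrpow_const (1 / q.toReal)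

lemma tendsto_eLpNorm_zero_of_le_add {q : ℝ≥0∞} (hq1 : 1 ≤ q) (hq : q ≠ ⊤) {f : ℕ → α → F}
    {a : ℕ → α → ℝ} {b : α → ℝ} (hf : ∀ n, AEStronglyMeasurable (f n) μ)
    (ha : ∀ n, AEStronglyMeasurable (a n) μ) (hb : MemLp b q μ)
    (ha0 : Tendsto (fun n => eLpNorm (a n) q μ) atTop (𝓝 0))
    (hle : ∀ n, ∀ᵐ x ∂μ, ‖f n x‖ ≤ a n x + b x) (hlim : ∀ᵐ x ∂μ, Tendsto (f · x) atTop (𝓝 0)) :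
    Tendsto (fun n => eLpNorm (f n) q μ) atTop (𝓝 0) := by
  set g : ℕ → α → ℝ := fun n x => max (‖f n x‖ - |a n x|) 0
  have hg (n) : AEStronglyMeasurable (g n) μ := ((hf n).norm.sub (ha n).norm).sup
    aestronglyMeasurable_const
  have hg0 : Tendsto (fun n => eLpNorm (g n) q μ) atTop (𝓝 0) := by
    refine tendsto_eLpNorm_zero_of_dominated (one_pos.trans_le hq1).ne' hq hg hb.norm
      (fun n => ?_) ?_
    · filter_upwards [hle n] with x hx
      rw [Real.norm_of_nonneg (le_max_right _ _), Real.norm_eq_abs]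
      refine max_le ?_ (abs_nonneg _)
      linarith [le_abs_self (a n x), le_abs_self (b x)]
    · filter_upwards [hlim] with x hx
      exact squeeze_zero (fun n => le_max_right _ _)
        (fun n => max_le (sub_le_self _ (abs_nonneg _)) (norm_nonneg _))
        (tendsto_zero_iff_norm_tendsto_zero.1 hx)
  refine tendsto_of_tendsto_of_tendsto_of_le_of_le tendsto_const_nhds (by simpa using hg0.add ha0)
    (fun _ => zero_le) fun n => ?_
  refine le_trans (eLpNorm_mono_real (g := g n + fun x => ‖a n x‖) fun x => ?_)
    ((eLpNorm_add_le (hg n) (ha n).norm hq1).trans_eq (by rw [eLpNorm_norm]))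
  simp only [g, Pi.add_apply, Real.norm_eq_abs]
  linarith [le_max_left (‖f n x‖ - |a n x|) 0]

end DominatedConvergence

lemma abs_increment_comp_le {E : Type*} {Φ : ℝ × ℝ → ℝ} {K : ℝ≥0} (hΦ : LipschitzWith K Φ)
    (a b : E → ℝ) (z : E × E) :
    |increment (fun x => Φ (a x, b x)) z| ≤ K * (|increment a z| + |increment b z|) := by
  calc |Φ (a z.1, b z.1) - Φ (a z.2, b z.2)|
      ≤ K * max |increment a z| |increment b z| := hΦ.dist_le_mul _ _
    _ ≤ K * (|increment a z| + |increment b z|) := by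
        gcongr
        exact max_le_add_of_nonneg (abs_nonneg _) (abs_nonneg _)

lemma increment_sub {E : Type*} (a b : E → ℝ) :
    increment (a - b) = increment a - increment b := by
  ext z; simp only [increment, Pi.sub_apply]; ring

lemma abs_increment_comp_sub_comp_le {E : Type*} {Φ Ψ : ℝ × ℝ → ℝ} {K : ℝ≥0}
    (hΦ : LipschitzWith K Φ) (hΨ : LipschitzWith K Ψ) (a b c d : E → ℝ) (z : E × E) :
    |increment (fun x => Ψ (a x, b x) - Φ (c x, d x)) z| ≤
      K * (|increment (a - c) z| + |increment (b - d) z|)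
        + 2 * K * (|increment c z| + |increment d z|) := by
  have hac := abs_sub_abs_le_abs_sub (increment a z) (increment c z)
  have hbd := abs_sub_abs_le_abs_sub (increment b z) (increment d z)
  calc |increment ((fun x => Ψ (a x, b x)) - fun x => Φ (c x, d x)) z|
      ≤ |increment (fun x => Ψ (a x, b x)) z| + |increment (fun x => Φ (c x, d x)) z| := by
        rw [increment_sub]; exact abs_sub _ _
    _ ≤ K * (|increment a z| + |increment b z|) + K * (|increment c z| + |increment d z|) :=
        add_le_add (abs_increment_comp_le hΨ a b z) (abs_increment_comp_le hΦ c d z)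
    _ ≤ K * ((|increment (a - c) z| + |increment c z|)
          + (|increment (b - d) z| + |increment d z|))
          + K * (|increment c z| + |increment d z|) := by
        simp only [increment_sub, Pi.sub_apply]
        gcongr <;> linarith
    _ = _ := by ring

lemma tendsto_comp_of_abs_sub_le {Φ : ℝ × ℝ → ℝ} (hΦ : Continuous Φ)
    {Ψ : ℕ → ℝ × ℝ → ℝ} (hΨ : ∀ n q, |Ψ n q - Φ q| ≤ 1 / ((n : ℝ) + 1)) {a : ℕ → ℝ × ℝ} {l : ℝ × ℝ}
    (ha : Tendsto a atTop (𝓝 l)) : Tendsto (fun n => Ψ n (a n)) atTop (𝓝 (Φ l)) := by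
  have hdiff : Tendsto (fun n => Ψ n (a n) - Φ (a n)) atTop (𝓝 0) :=
    squeeze_zero_norm (fun n => hΨ n _) tendsto_one_div_add_atTop_nhds_zero_nat
  simpa using hdiff.add ((hΦ.tendsto l).comp ha)

lemma tendsto_energy_comp_sub_comp (hp : 1 ≤ p) {φ ψ : ℕ → RN N → ℝ}
    (hφ : ∀ n, AEMeasurable (φ n)) (hψ : ∀ n, AEMeasurable (ψ n)) (hu : AEMeasurable u)
    (hv : AEMeasurable v) (hφE : Tendsto (fun n => energy s p (φ n - u)) atTop (𝓝 0))
    (hψE : Tendsto (fun n => energy s p (ψ n - v)) atTop (𝓝 0)) (huE : energy s p u ≠ ⊤)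
    (hvE : energy s p v ≠ ⊤) {Φ : ℝ × ℝ → ℝ} {Ψ : ℕ → ℝ × ℝ → ℝ} {K : ℝ≥0}
    (hΦ : LipschitzWith K Φ) (hΨ : ∀ n, LipschitzWith K (Ψ n))
    (hlim : ∀ᵐ x, Tendsto (fun n => Ψ n (φ n x, ψ n x)) atTop (𝓝 (Φ (u x, v x)))) :
    Tendsto (fun n => energy s p fun x => Ψ n (φ n x, ψ n x) - Φ (u x, v x)) atTop (𝓝 0) := by
  have hp0 : 0 < p := one_pos.trans_le hp
  rw [tendsto_energy_zero_iff hp0] at hφE hψE ⊢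
  rw [← memLp_increment_iff hp0 hu] at huE
  rw [← memLp_increment_iff hp0 hv] at hvE
  have hA (n) := (aestronglyMeasurable_increment (s := s) (p := p) ((hφ n).sub hu)).norm
  have hB (n) := (aestronglyMeasurable_increment (s := s) (p := p) ((hψ n).sub hv)).norm
  refine tendsto_eLpNorm_zero_of_le_add (by simpa using hp) ENNReal.ofReal_ne_top
    (a := fun n z => K * (|increment (φ n - u) z| + |increment (ψ n - v) z|))
    (b := fun z => 2 * K * (|increment u z| + |increment v z|)) (fun n => ?_)
    (fun n => ((hA n).add (hB n)).const_mul _) ((huE.abs.add hvE.abs).const_mul _) ?_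
    (fun n => .of_forall fun z => abs_increment_comp_sub_comp_le hΦ (hΨ n) _ _ _ _ z) ?_
  · exact aestronglyMeasurable_increment
      (((hΨ n).continuous.measurable.comp_aemeasurable ((hφ n).prodMk (hψ n))).sub
        (hΦ.continuous.measurable.comp_aemeasurable (hu.prodMk hv)))
  · exact tendsto_eLpNorm_const_mul_add_zero (by simpa using hp) hA hB
      (by simpa only [eLpNorm_norm] using hφE) (by simpa only [eLpNorm_norm] using hψE) K
  · filter_upwards [ae_gagliardoMeasure_of_ae hlim] with z ⟨hz₁, hz₂⟩
    simpa [increment] using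
      (hz₁.sub_const (Φ (u z.1, v z.1))).sub (hz₂.sub_const (Φ (u z.2, v z.2)))

theorem MemD.comp₂ (hs0 : 0 < s) (hs1 : s < 1) (hp : 1 ≤ p) (hu : MemD s p u) (hv : MemD s p v)
    {Φ : ℝ × ℝ → ℝ} {K : ℝ≥0} (hΦ : LipschitzWith K Φ) (hΦ0 : Φ 0 = 0) :
    MemD s p (fun x => Φ (u x, v x)) := by
  have hum := hu.aemeasurable
  have hvm := hv.aemeasurable
  have huE := hu.energy_ne_top hs0 hs1 (one_pos.trans_le hp)
  have hvE := hv.energy_ne_top hs0 hs1 (one_pos.trans_le hp)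
  obtain ⟨φ, hφ, hφE, hφu⟩ := hu
  obtain ⟨ψ, hψ, hψE, hψv⟩ := hv
  choose Ψ hΨ hΨK hΨ0 hΨΦ using fun n : ℕ =>
    exists_contDiff_lipschitzWith_eq_zero_abs_sub_le hΦ hΦ0 (Nat.one_div_pos_of_nat (n := n))
  have hlim : ∀ᵐ x, Tendsto (fun n => Ψ n (φ n x, ψ n x)) atTop (𝓝 (Φ (u x, v x))) := by
    filter_upwards [hφu, hψv] with x hx hx'
    exact tendsto_comp_of_abs_sub_le hΦ.continuous hΨΦ (hx.prodMk_nhds hx')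
  exact ⟨fun n x => Ψ n (φ n x, ψ n x), fun n => ⟨(hΨ n).comp ((hφ n).1.prodMk (hψ n).1),
    (hφ n).2.comp₂_left (m := fun a b => Ψ n (a, b)) (hψ n).2 (hΨ0 n)⟩,
    tendsto_energy_comp_sub_comp hp (fun n => (hφ n).1.continuous.aemeasurable)
      (fun n => (hψ n).1.continuous.aemeasurable) hum hvm hφE hψE huE hvE hΦ hΨK hlim, hlim⟩

theorem MemD.comp (hs0 : 0 < s) (hs1 : s < 1) (hp : 1 ≤ p) (hu : MemD s p u) {Φ : ℝ → ℝ} {K : ℝ≥0}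
    (hΦ : LipschitzWith K Φ) (hΦ0 : Φ 0 = 0) : MemD s p (fun x => Φ (u x)) :=
  hu.comp₂ hs0 hs1 hp hu (Φ := fun q => Φ q.1) (K := K)
    (by simpa [Function.comp_def] using hΦ.comp LipschitzWith.prod_fst) hΦ0

lemma MemD.const_mul (hs0 : 0 < s) (hs1 : s < 1) (hp : 1 ≤ p) (hu : MemD s p u) (c : ℝ) :
    MemD s p (fun x => c * u x) :=
  hu.comp hs0 hs1 hp (lipschitzWith_smul c) (mul_zero c)

lemma energy_const_mul (hp : 0 ≤ p) (c : ℝ) (u : RN N → ℝ) :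
    energy s p (fun x => c * u x) = ENNReal.ofReal (|c| ^ p) * energy s p u := by
  simp only [energy_eq_lintegral_enorm_rpow hp]
  rw [← lintegral_const_mul' _ _ ENNReal.ofReal_ne_top]
  refine lintegral_congr fun z => ?_
  rw [increment, ← mul_sub, enorm_mul, ENNReal.mul_rpow_of_nonneg _ _ hp,
    ← ENNReal.ofReal_rpow_of_nonneg (abs_nonneg c) hp, Real.enorm_eq_ofReal_abs c]
  rfl

/-! ### Local integral bounds below the critical exponent -/

section LocalBound

open Metric
open scoped ProbabilityTheory

lemma lintegral_enorm_le_add_eLpNorm_increment {α : Type*} [MeasurableSpace α] (P Q : Measure α)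
    [IsProbabilityMeasure P] [IsProbabilityMeasure Q] {q : ℝ≥0∞} (hq : 1 ≤ q) {f : α → ℝ}
    (hf : Measurable f) :
    ∫⁻ x, ‖f x‖ₑ ∂P ≤ ∫⁻ x, ‖f x‖ₑ ∂Q + eLpNorm (increment f) q (P.prod Q) := by
  have hinc : Measurable (increment f) := (hf.comp measurable_fst).sub (hf.comp measurable_snd)
  calc ∫⁻ x, ‖f x‖ₑ ∂P = ∫⁻ z, ‖f z.1‖ₑ ∂P.prod Q :=
        (measurePreserving_fst.lintegral_comp hf.enorm).symm
    _ ≤ ∫⁻ z, (‖f z.2‖ₑ + ‖increment f z‖ₑ) ∂P.prod Q := by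
        refine lintegral_mono fun z => ?_
        simpa [increment] using enorm_add_le (f z.2) (f z.1 - f z.2)
    _ = ∫⁻ x, ‖f x‖ₑ ∂Q + eLpNorm (increment f) 1 (P.prod Q) := by
        rw [lintegral_add_right _ hinc.enorm, eLpNorm_one_eq_lintegral_enorm]
        exact congrArg (· + _) (measurePreserving_snd.lintegral_comp hf.enorm)
    _ ≤ _ := by
        gcongr
        exact eLpNorm_le_eLpNorm_of_exponent_le hq hinc.aestronglyMeasurable

lemma setLIntegral_enorm_increment_rpow_le (hs : 0 ≤ s) (hp : 0 < p) (f : RN N → ℝ)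
    {S T : Set (RN N)} (hS : MeasurableSet S) (hT : MeasurableSet T) {D : ℝ}
    (hD : ∀ x ∈ S, ∀ y ∈ T, ‖x - y‖ ≤ D) :
    ∫⁻ z in S ×ˢ T, ‖increment f z‖ₑ ^ p ≤
      ENNReal.ofReal (D ^ ((N : ℝ) + s * p)) * energy s p f := by
  rw [energy, ← lintegral_const_mul' _ _ ENNReal.ofReal_ne_top]
  refine (setLIntegral_mono' (hS.prod hT) fun z hz => ?_).trans (setLIntegral_le_lintegral _ _)
  have hzD := hD _ hz.1 _ hz.2
  have hD0 : 0 ≤ D := (norm_nonneg _).trans hzD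
  rw [← ofReal_norm, ENNReal.ofReal_rpow_of_nonneg (norm_nonneg _) hp.le,
    ← ENNReal.ofReal_mul (by positivity)]
  refine ENNReal.ofReal_le_ofReal ?_
  simp only [increment, Real.norm_eq_abs]
  rcases eq_or_ne z.1 z.2 with h | h
  · simp [h, Real.zero_rpow hp.ne']
  · have hpos : 0 < ‖z.1 - z.2‖ := norm_sub_pos_iff.2 h
    rw [← mul_div_assoc, le_div_iff₀ (by positivity), mul_comm]
    gcongr

lemma eLpNorm_increment_prod_cond_le (hs : 0 ≤ s) (hp : 0 < p) (f : RN N → ℝ)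
    {S T : Set (RN N)} (hS : MeasurableSet S) (hT : MeasurableSet T) {D : ℝ}
    (hD : ∀ x ∈ S, ∀ y ∈ T, ‖x - y‖ ≤ D) :
    eLpNorm (increment f) (ENNReal.ofReal p) (volume[|S].prod volume[|T]) ≤
      ((volume S)⁻¹ * (volume T)⁻¹ * ENNReal.ofReal (D ^ ((N : ℝ) + s * p))) ^ p⁻¹ *
        eLpNorm (increment f) (ENNReal.ofReal p) (gagliardoMeasure N s p) := by
  rw [← ENNReal.rpow_le_rpow_iff hp, ENNReal.mul_rpow_of_nonneg _ _ hp.le,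
    ENNReal.rpow_inv_rpow hp.ne', ← energy_eq_eLpNorm_rpow hp, mul_assoc,
    eLpNorm_eq_lintegral_rpow_enorm_toReal (by simpa) ENNReal.ofReal_ne_top,
    ENNReal.toReal_ofReal hp.le, one_div, ENNReal.rpow_inv_rpow hp.ne', ProbabilityTheory.cond,
    ProbabilityTheory.cond, Measure.prod_smul_left, Measure.prod_smul_right, Measure.prod_restrict,
    lintegral_smul_measure, lintegral_smul_measure, smul_eq_mul, smul_eq_mul, mul_assoc]
  gcongr
  exact setLIntegral_enorm_increment_rpow_le hs hp f hS hT hD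

lemma exists_eLpNorm_increment_prod_cond_ball_le (N : ℕ) (hs : 0 ≤ s) (hp : 0 < p) :
    ∃ A ≠ (⊤ : ℝ≥0∞), ∀ r > (0 : ℝ), ∀ f : RN N → ℝ,
      eLpNorm (increment f) (ENNReal.ofReal p) (volume[|ball 0 r].prod volume[|ball 0 (2 * r)]) ≤
        A * ENNReal.ofReal (r ^ ((s * p - N) / p)) *
          eLpNorm (increment f) (ENNReal.ofReal p) (gagliardoMeasure N s p) := by
  set V : ℝ := volume.real (ball (0 : RN N) 1)
  have hV : 0 < V := ENNReal.toReal_pos (measure_ball_pos _ _ one_pos).ne' measure_ball_lt_top.ne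
  have volume_ball {r : ℝ} (hr : 0 < r) :
      volume (ball (0 : RN N) r) = ENNReal.ofReal (r ^ N * V) := by
    rw [Measure.addHaar_ball_of_pos _ _ hr, finrank_euclideanSpace_fin,
      ENNReal.ofReal_mul (by positivity), ofReal_measureReal measure_ball_lt_top.ne]
  set A : ℝ := V⁻¹ * V⁻¹ * (2 ^ N)⁻¹ * 3 ^ ((N : ℝ) + s * p)
  refine ⟨ENNReal.ofReal (A ^ p⁻¹), ENNReal.ofReal_ne_top, fun r hr f => ?_⟩
  refine (eLpNorm_increment_prod_cond_le hs hp f measurableSet_ball measurableSet_ball (D := 3 * r)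
    fun x hx y hy => ?_).trans_eq ?_
  · rw [mem_ball_zero_iff] at hx hy
    linarith [norm_sub_le x y]
  · have hA : (r ^ N * V)⁻¹ * ((2 * r) ^ N * V)⁻¹ * (3 * r) ^ ((N : ℝ) + s * p)
        = A * r ^ (s * p - N) := by
      rw [Real.mul_rpow (by positivity) hr.le, Real.rpow_add hr, Real.rpow_sub hr,
        Real.rpow_natCast, mul_pow]
      simp only [A]
      field_simp
    rw [volume_ball hr, volume_ball (by positivity), ← ENNReal.ofReal_inv_of_pos (by positivity),
      ← ENNReal.ofReal_inv_of_pos (by positivity), ← ENNReal.ofReal_mul (by positivity),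
      ← ENNReal.ofReal_mul (by positivity), hA, ENNReal.ofReal_rpow_of_pos (by positivity),
      Real.mul_rpow (by positivity) (by positivity), ← Real.rpow_mul hr.le,
      ENNReal.ofReal_mul (by positivity), div_eq_mul_inv]

lemma le_tsum_of_le_add_of_tendsto_zero {a b : ℕ → ℝ≥0∞} (hab : ∀ k, a k ≤ a (k + 1) + b k)
    (ha : Tendsto a atTop (𝓝 0)) : a 0 ≤ ∑' k, b k := by
  have h (n : ℕ) : a 0 ≤ a n + ∑' k, b k := by
    refine le_trans ?_ (add_le_add_right (ENNReal.sum_le_tsum (Finset.range n)) _)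
    induction n with
    | zero => simp
    | succ n ih =>
      calc a 0 ≤ a n + ∑ k ∈ Finset.range n, b k := ih
        _ ≤ a (n + 1) + b n + ∑ k ∈ Finset.range n, b k := by gcongr; exact hab n
        _ = _ := by rw [Finset.sum_range_succ]; ring
  simpa using ge_of_tendsto' (ha.add_const (∑' k, b k)) h

lemma tendsto_lintegral_cond_ball_atTop {E : Type*} [NormedAddCommGroup E] [NormedSpace ℝ E]
    [FiniteDimensional ℝ E] [Nontrivial E] [MeasurableSpace E] [BorelSpace E] (μ : Measure E)
    [μ.IsAddHaarMeasure] {f : E → ℝ≥0∞} (hf : ∫⁻ x, f x ∂μ ≠ ⊤) :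
    Tendsto (fun r : ℝ => ∫⁻ x, f x ∂μ[|ball 0 r]) atTop (𝓝 0) := by
  have hball : Tendsto (fun r : ℝ => μ (ball (0 : E) r)) atTop (𝓝 ⊤) := by
    have := NormedSpace.noncompactSpace ℝ E
    have hcover : ⋃ r : ℝ, ball (0 : E) r = Set.univ :=
      Set.eq_univ_of_forall fun x => Set.mem_iUnion.2 ⟨‖x‖ + 1, by simp⟩
    rw [← measure_univ_of_isAddLeftInvariant μ, ← hcover]
    exact tendsto_measure_iUnion_atTop fun _ _ => ball_subset_ball
  have h := ENNReal.Tendsto.mul_const (tendsto_inv_iff.2 hball) (.inr hf)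
  rw [ENNReal.inv_top, zero_mul] at h
  refine tendsto_of_tendsto_of_tendsto_of_le_of_le tendsto_const_nhds h (fun _ => zero_le)
    fun r => ?_
  simp only [ProbabilityTheory.cond, lintegral_smul_measure, smul_eq_mul]
  gcongr
  exact Measure.restrict_le_self

lemma isProbabilityMeasure_cond_ball {r : ℝ} (hr : 0 < r) :
    IsProbabilityMeasure (volume[|ball (0 : RN N) r]) :=
  ProbabilityTheory.cond_isProbabilityMeasure_of_finite (measure_ball_pos _ _ hr).ne'
    measure_ball_lt_top.ne

-- Telescope the averages of `|f|` over the balls of radius `2 ^ k * r`: they tend to `0`, and the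
-- successive errors `(2 ^ k * r) ^ ((s * p - N) / p)` are summable because `s * p < N`.
lemma exists_lintegral_enorm_cond_ball_le (hs : 0 ≤ s) (hp : 1 ≤ p) (hN : s * p < N) {r : ℝ}
    (hr : 0 < r) : ∃ C ≠ (⊤ : ℝ≥0∞), ∀ f : RN N → ℝ, Measurable f → Integrable f →
      ∫⁻ x, ‖f x‖ₑ ∂volume[|ball 0 r] ≤
        C * eLpNorm (increment f) (ENNReal.ofReal p) (gagliardoMeasure N s p) := by
  have hp0 : 0 < p := one_pos.trans_le hp
  have : Nonempty (Fin N) := ⟨0, by exact_mod_cast (mul_nonneg hs hp0.le).trans_lt hN⟩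
  obtain ⟨A, hA, hAle⟩ := exists_eLpNorm_increment_prod_cond_ball_le N hs hp0
  set β : ℝ := (s * p - N) / p
  have hβ : β < 0 := div_neg_of_neg_of_pos (by linarith) hp0
  set ρ : ℝ≥0∞ := ENNReal.ofReal (2 ^ β)
  have hρ : ρ < 1 :=
    ENNReal.ofReal_lt_one.2 (Real.rpow_lt_one_of_one_lt_of_neg one_lt_two hβ)
  refine ⟨A * ENNReal.ofReal (r ^ β) * (1 - ρ)⁻¹, ?_, fun f hfm hfi => ?_⟩
  · exact ENNReal.mul_ne_top (ENNReal.mul_ne_top hA ENNReal.ofReal_ne_top)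
      (ENNReal.inv_ne_top.2 (tsub_pos_of_lt hρ).ne')
  set S := eLpNorm (increment f) (ENNReal.ofReal p) (gagliardoMeasure N s p)
  have htele (k : ℕ) : ∫⁻ x, ‖f x‖ₑ ∂volume[|ball 0 (2 ^ k * r)] ≤
      ∫⁻ x, ‖f x‖ₑ ∂volume[|ball 0 (2 ^ (k + 1) * r)] + A * ENNReal.ofReal (r ^ β) * S * ρ ^ k := by
    have := isProbabilityMeasure_cond_ball (N := N) (r := 2 ^ k * r) (by positivity)
    have := isProbabilityMeasure_cond_ball (N := N) (r := 2 * (2 ^ k * r)) (by positivity)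
    have hk : ENNReal.ofReal ((2 ^ k * r) ^ β) = ENNReal.ofReal (r ^ β) * ρ ^ k := by
      rw [Real.mul_rpow (by positivity) hr.le, mul_comm, ENNReal.ofReal_mul (by positivity),
        ← ENNReal.ofReal_pow (by positivity), Real.rpow_pow_comm zero_le_two]
    rw [pow_succ', mul_assoc 2]
    refine (lintegral_enorm_le_add_eLpNorm_increment volume[|ball 0 (2 ^ k * r)]
      volume[|ball 0 (2 * (2 ^ k * r))] (ENNReal.one_le_ofReal.2 hp) hfm).trans ?_
    gcongr
    refine (hAle (2 ^ k * r) (by positivity) f).trans_eq ?_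
    rw [hk]
    ring
  have hradii : Tendsto (fun k : ℕ => 2 ^ k * r) atTop atTop :=
    (tendsto_pow_atTop_atTop_of_one_lt one_lt_two).atTop_mul_const hr
  have h := le_tsum_of_le_add_of_tendsto_zero htele
    ((tendsto_lintegral_cond_ball_atTop volume hfi.2.ne).comp hradii)
  rw [ENNReal.tsum_mul_left, ENNReal.tsum_geometric, pow_zero, one_mul] at h
  exact h.trans_eq (by ring)

lemma MemD.exists_lintegral_enorm_cond_ball_le (hs0 : 0 < s) (hs1 : s < 1) (hp : 1 ≤ p)
    (hN : s * p < N) {r : ℝ} (hr : 0 < r) : ∃ C ≠ (⊤ : ℝ≥0∞), ∀ u : RN N → ℝ, MemD s p u →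
      ∫⁻ x, ‖u x‖ₑ ∂volume[|ball 0 r] ≤
        C * eLpNorm (increment u) (ENNReal.ofReal p) (gagliardoMeasure N s p) := by
  obtain ⟨C, hC, hCle⟩ := FracHardy.exists_lintegral_enorm_cond_ball_le hs0.le hp hN hr
  refine ⟨C, hC, fun u hu => ?_⟩
  have hum := hu.aemeasurable
  have hdu := hu.memLp_increment hs0 hs1 (one_pos.trans_le hp)
  obtain ⟨φ, hφ, hE, hlim⟩ := hu
  have hφm (n) : Measurable (φ n) := (hφ n).1.continuous.measurable
  set S : (RN N → ℝ) → ℝ≥0∞ :=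
    fun f => eLpNorm (increment f) (ENNReal.ofReal p) (gagliardoMeasure N s p)
  have hS (n) : S (φ n) ≤ S (φ n - u) + S u := by
    have hsplit : increment (φ n) = increment (φ n - u) + increment u := by
      rw [increment_sub, sub_add_cancel]
    simp only [S]
    rw [hsplit]
    exact eLpNorm_add_le (aestronglyMeasurable_increment ((hφm n).aemeasurable.sub hum)) hdu.1
      (ENNReal.one_le_ofReal.2 hp)
  have hSlim : Tendsto (fun n => C * (S (φ n - u) + S u)) atTop (𝓝 (C * S u)) := by
    have := ((tendsto_energy_zero_iff (one_pos.trans_le hp)).1 hE).add_const (S u)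
    rw [zero_add] at this
    exact ENNReal.Tendsto.const_mul this (.inr hC)
  calc ∫⁻ x, ‖u x‖ₑ ∂volume[|ball 0 r]
      = ∫⁻ x, liminf (fun n => ‖φ n x‖ₑ) atTop ∂volume[|ball 0 r] := by
        refine lintegral_congr_ae (ProbabilityTheory.cond_absolutelyContinuous.ae_le ?_)
        filter_upwards [hlim] with x hx using hx.enorm.liminf_eq.symm
    _ ≤ liminf (fun n => ∫⁻ x, ‖φ n x‖ₑ ∂volume[|ball 0 r]) atTop :=
        lintegral_liminf_le fun n => (hφm n).enorm
    _ ≤ liminf (fun n => C * (S (φ n - u) + S u)) atTop :=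
        liminf_le_liminf <| .of_forall fun n => (hCle (φ n) (hφm n)
          ((hφ n).1.continuous.integrable_of_hasCompactSupport (hφ n).2)).trans
            (mul_le_mul_right (hS n) C)
    _ = C * S u := hSlim.liminf_eq

lemma MemD.ae_eq_zero_of_energy_eq_zero (hs0 : 0 < s) (hs1 : s < 1) (hp : 1 ≤ p)
    (hN : s * p < N) (hu : MemD s p u) (hE : energy s p u = 0) : ∀ᵐ x, u x = 0 := by
  have hp0 : 0 < p := one_pos.trans_le hp
  have hdu : eLpNorm (increment u) (ENNReal.ofReal p) (gagliardoMeasure N s p) = 0 := by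
    rwa [energy_eq_eLpNorm_rpow hp0, ENNReal.rpow_eq_zero_iff_of_pos hp0] at hE
  have on_ball (n : ℕ) : ∀ᵐ x, x ∈ ball (0 : RN N) (n + 1) → u x = 0 := by
    obtain ⟨C, -, hC⟩ := MemD.exists_lintegral_enorm_cond_ball_le hs0 hs1 hp hN n.cast_add_one_pos
    have h := hC u hu
    rw [hdu, mul_zero, nonpos_iff_eq_zero, ProbabilityTheory.cond, lintegral_smul_measure,
      smul_eq_mul, mul_eq_zero, or_iff_right (ENNReal.inv_ne_zero.2 measure_ball_lt_top.ne),
      lintegral_eq_zero_iff' hu.aemeasurable.enorm.restrict] at h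
    rw [← ae_restrict_iff' measurableSet_ball]
    filter_upwards [h] with x hx using enorm_eq_zero.1 hx
  filter_upwards [ae_all_iff.2 on_ball] with x hx
  obtain ⟨n, hn⟩ := exists_nat_gt ‖x‖
  exact hx n (mem_ball_zero_iff.2 (hn.trans (lt_add_one _)))

end LocalBound

/-! ### Picone's inequality -/

lemma abs_rpow_sub_two_mul_abs (hp : p ≠ 1) (a : ℝ) : |a| ^ (p - 2) * |a| = |a| ^ (p - 1) := by
  have hp' : p - 1 ≠ 0 := sub_ne_zero.2 hp
  rcases eq_or_ne a 0 with rfl | ha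
  · simp [Real.zero_rpow hp']
  · rw [← Real.rpow_add_one (abs_ne_zero.2 ha)]
    ring_nf

lemma abs_rpow_sub_two_mul_mul_self (hp : p ≠ 0) (a : ℝ) : |a| ^ (p - 2) * a * a = |a| ^ p := by
  rcases eq_or_ne a 0 with rfl | ha
  · simp [Real.zero_rpow hp]
  · rw [mul_assoc, ← abs_mul_abs_self, ← mul_assoc, ← Real.rpow_add_one (abs_ne_zero.2 ha),
      ← Real.rpow_add_one (abs_ne_zero.2 ha)]
    ring_nf

lemma abs_weakIntegrand_le {E : Type*} (hp : 1 < p) (u v : E → ℝ) (z : E × E) :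
    |weakIntegrand p u v z| ≤ |increment u z| ^ p + |increment v z| ^ p := by
  set a := |increment u z|
  set b := |increment v z|
  have hp0 : 0 < p := by linarith
  have ha : 0 ≤ a := abs_nonneg _
  have hb : 0 ≤ b := abs_nonneg _
  calc |weakIntegrand p u v z| = a ^ (p - 1) * b := by
        rw [weakIntegrand, abs_mul, abs_mul, abs_of_nonneg (by positivity),
          abs_rpow_sub_two_mul_abs hp.ne']
    _ ≤ max a b ^ (p - 1) * max a b := by
        have : 0 ≤ p - 1 := by linarith
        gcongr
        exacts [le_max_left a b, le_max_right a b]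
    _ = max a b ^ p := by
        rw [← Real.rpow_add_one' (by positivity) (by simpa using hp0.ne'), sub_add_cancel]
    _ ≤ a ^ p + b ^ p := by
        rcases max_choice a b with h | h <;> rw [h] <;>
          linarith [Real.rpow_nonneg ha p, Real.rpow_nonneg hb p]

lemma integrable_abs_increment_rpow (hp : 0 < p)
    (hu : MemLp (increment u) (ENNReal.ofReal p) (gagliardoMeasure N s p)) :
    Integrable (fun z => |increment u z| ^ p) (gagliardoMeasure N s p) := by
  simpa [hp.le] using hu.integrable_norm_rpow (by simpa) ENNReal.ofReal_ne_top

lemma integral_abs_increment_rpow (hp : 0 ≤ p) (hu : AEMeasurable u) :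
    ∫ z, |increment u z| ^ p ∂gagliardoMeasure N s p = (energy s p u).toReal := by
  have hdu := (aestronglyMeasurable_increment (s := s) (p := p) hu).aemeasurable
  rw [integral_eq_lintegral_of_nonneg_ae (.of_forall fun z => by positivity)
    (hdu.abs.pow_const p).aestronglyMeasurable, energy_eq_lintegral_enorm_rpow hp]
  simp only [Real.enorm_eq_ofReal_abs, ENNReal.ofReal_rpow_of_nonneg (abs_nonneg _) hp]

lemma integrable_weakIntegrand (hp : 1 < p)
    (hu : MemLp (increment u) (ENNReal.ofReal p) (gagliardoMeasure N s p))
    (hv : MemLp (increment v) (ENNReal.ofReal p) (gagliardoMeasure N s p)) :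
    Integrable (weakIntegrand p u v) (gagliardoMeasure N s p) := by
  have hp0 : 0 < p := by linarith
  have hum := hu.1.aemeasurable
  refine ((integrable_abs_increment_rpow hp0 hu).add (integrable_abs_increment_rpow hp0 hv)).mono'
    (((hum.abs.pow_const _).mul hum).mul hv.1.aemeasurable).aestronglyMeasurable
    (.of_forall (abs_weakIntegrand_le hp u v))

lemma weakForm_self (hp : 0 < p) (hu : AEMeasurable u) :
    weakForm s p u u = (energy s p u).toReal := by
  simp only [weakForm_eq_integral, weakIntegrand, abs_rpow_sub_two_mul_mul_self hp.ne',
    integral_abs_increment_rpow hp.le hu]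

/-- The function `(min |v| k) ^ p / (|u| + ε) ^ (p - 1)`: the test function `|v| ^ p / u ^ (p - 1)`
of Picone's inequality, truncated and regularized so that it is a Lipschitz function of `(u, v)`. -/
noncomputable def piconeTest {E : Type*} (p k ε : ℝ) (u v : E → ℝ) (x : E) : ℝ :=
  min |v x| k ^ p / (|u x| + ε) ^ (p - 1)

lemma lipschitzWith_mul_of_abs_le {f g : ℝ → ℝ} {K L A B : ℝ≥0} (hf : LipschitzWith K f)
    (hg : LipschitzWith L g) (hA : ∀ x, |f x| ≤ A) (hB : ∀ x, |g x| ≤ B) :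
    LipschitzWith (B * K + A * L) fun q : ℝ × ℝ => f q.1 * g q.2 := by
  refine LipschitzWith.of_dist_le_mul fun a b => ?_
  have h₁ : |f a.1 - f b.1| ≤ K * dist a b :=
    (hf.dist_le_mul _ _).trans (by gcongr; exact le_max_left _ _)
  have h₂ : |g a.2 - g b.2| ≤ L * dist a b :=
    (hg.dist_le_mul _ _).trans (by gcongr; exact le_max_right _ _)
  calc |f a.1 * g a.2 - f b.1 * g b.2|
      = |g a.2 * (f a.1 - f b.1) + f b.1 * (g a.2 - g b.2)| := by ring_nf
    _ ≤ |g a.2| * |f a.1 - f b.1| + |f b.1| * |g a.2 - g b.2| := by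
        simp only [← abs_mul, abs_add_le]
    _ ≤ B * (K * dist a b) + A * (L * dist a b) := by
        gcongr
        exacts [hB _, hA _]
    _ = (B * K + A * L : ℝ≥0) * dist a b := by push_cast; ring

lemma lipschitzWith_abs : LipschitzWith 1 fun x : ℝ => |x| :=
  lipschitzWith_one_norm

lemma exists_lipschitzWith_min_abs_rpow (hp : 1 ≤ p) {k : ℝ} (hk : 0 ≤ k) :
    ∃ K, LipschitzWith K fun x : ℝ => min |x| k ^ p := by
  have hrpow : ContDiff ℝ 1 fun t : ℝ => t ^ p :=
    mod_cast Real.contDiff_rpow_const_of_le (n := 1) (mod_cast hp)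
  obtain ⟨K, hK⟩ := (hrpow.locallyLipschitz.locallyLipschitzOn
    (s := Set.Icc 0 k)).exists_lipschitzOnWith_of_compact isCompact_Icc
  refine ⟨K * 1, lipschitzOnWith_univ.1 (hK.comp
    (lipschitzWith_abs.min_const k).lipschitzOnWith fun x _ => ?_)⟩
  exact ⟨le_min (abs_nonneg x) hk, min_le_right _ _⟩

lemma exists_lipschitzWith_inv_abs_add_rpow {q ε : ℝ} (hq : 0 ≤ q) (hε : 0 < ε) :
    ∃ K, LipschitzWith K fun x : ℝ => ((|x| + ε) ^ q)⁻¹ := by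
  have hinv : LipschitzOnWith (Real.toNNReal (q * ε ^ (-q - 1))) (fun t : ℝ => t ^ (-q))
      (Set.Ici ε) := by
    refine (convex_Ici ε).lipschitzOnWith_of_nnnorm_hasDerivWithin_le
      (f' := fun t => -q * t ^ (-q - 1)) (fun t ht => ?_) fun t ht => ?_
    · exact (Real.hasDerivAt_rpow_const (.inl (hε.trans_le ht).ne')).hasDerivWithinAt
    · rw [← norm_toNNReal, norm_mul, norm_neg, Real.norm_of_nonneg hq,
        Real.norm_of_nonneg (Real.rpow_nonneg (hε.le.trans ht) _)]
      exact Real.toNNReal_le_toNNReal (mul_le_mul_of_nonneg_left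
        (Real.rpow_le_rpow_of_nonpos hε ht (by linarith)) hq)
  simp only [← Real.rpow_neg (add_nonneg (abs_nonneg _) hε.le)]
  exact ⟨_, lipschitzOnWith_univ.1 <|
    hinv.comp (lipschitzWith_abs.add (.const ε)).lipschitzOnWith fun x _ => by simp⟩

lemma memD_piconeTest (hs0 : 0 < s) (hs1 : s < 1) (hp : 1 ≤ p) (hu : MemD s p u)
    (hv : MemD s p v) {k ε : ℝ} (hk : 0 ≤ k) (hε : 0 < ε) : MemD s p (piconeTest p k ε u v) := by
  obtain ⟨K, hK⟩ := exists_lipschitzWith_min_abs_rpow hp hk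
  obtain ⟨L, hL⟩ := exists_lipschitzWith_inv_abs_add_rpow (sub_nonneg.2 hp) hε
  have hnum (x : ℝ) : |min |x| k ^ p| ≤ Real.toNNReal (k ^ p) := by
    have : 0 ≤ min |x| k := le_min (abs_nonneg x) hk
    rw [Real.coe_toNNReal _ (by positivity), abs_of_nonneg (by positivity)]
    gcongr
    exact min_le_right _ _
  have hden (x : ℝ) : |((|x| + ε) ^ (p - 1))⁻¹| ≤ Real.toNNReal (ε ^ (p - 1))⁻¹ := by
    have : 0 ≤ p - 1 := sub_nonneg.2 hp
    rw [Real.coe_toNNReal _ (by positivity), abs_of_nonneg (by positivity)]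
    gcongr
    simp
  have h := hv.comp₂ hs0 hs1 hp hu (lipschitzWith_mul_of_abs_le hK hL hnum hden)
    (by simp [hk, Real.zero_rpow (one_pos.trans_le hp).ne'])
  simp only [← div_eq_mul_inv] at h
  exact h

-- The perspective function `y * (x / y) ^ p` of the convex function `x ^ p` is subadditive.
lemma add_rpow_div_add_rpow_le (hp : 1 ≤ p) {a b c d : ℝ} (ha : 0 < a) (hb : 0 < b)
    (hc : 0 ≤ c) (hd : 0 ≤ d) :
    (c + d) ^ p / (a + b) ^ (p - 1) ≤ c ^ p / a ^ (p - 1) + d ^ p / b ^ (p - 1) := by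
  have hab : 0 < a + b := by positivity
  have perspective {x y : ℝ} (hx : 0 ≤ x) (hy : 0 < y) :
      x ^ p / y ^ (p - 1) = y * (x / y) ^ p := by
    rw [Real.div_rpow hx hy.le, Real.rpow_sub_one hy.ne']
    field_simp
  rw [perspective (by positivity) hab, perspective hc ha, perspective hd hb]
  have hconvex := (convexOn_rpow hp).2 (Set.mem_Ici.2 (div_nonneg hc ha.le))
    (Set.mem_Ici.2 (div_nonneg hd hb.le)) (div_nonneg ha.le hab.le) (div_nonneg hb.le hab.le)
    (by field_simp)
  calc (a + b) * ((c + d) / (a + b)) ^ p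
      = (a + b) * (a / (a + b) * (c / a) + b / (a + b) * (d / b)) ^ p := by
        congr 2
        field_simp
    _ ≤ (a + b) * (a / (a + b) * (c / a) ^ p + b / (a + b) * (d / b) ^ p) := by
        gcongr
        exact hconvex
    _ = a * (c / a) ^ p + b * (d / b) ^ p := by field_simp

lemma picone_inequality (hp : 1 < p) {a b c d : ℝ} (ha : 0 < a) (hb : 0 < b)
    (hc : 0 ≤ c) (hd : 0 ≤ d) :
    |a - b| ^ (p - 2) * (a - b) * (c ^ p / a ^ (p - 1) - d ^ p / b ^ (p - 1)) ≤ |c - d| ^ p := by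
  wlog hab : b ≤ a generalizing a b c d
  · have := this hb ha hd hc (le_of_not_ge hab)
    rw [abs_sub_comm b a, abs_sub_comm d c] at this
    linarith
  rcases hab.eq_or_lt with rfl | hab
  · simpa using Real.rpow_nonneg (abs_nonneg (c - d)) p
  have hpos : 0 < a - b := sub_pos.2 hab
  have hcoef : |a - b| ^ (p - 2) * (a - b) = (a - b) ^ (p - 1) := by
    simpa only [abs_of_pos hpos] using abs_rpow_sub_two_mul_abs hp.ne' (a - b)
  rw [hcoef]
  rcases le_total c d with hcd | hdc
  · have hle : c ^ p / a ^ (p - 1) ≤ d ^ p / b ^ (p - 1) := by gcongr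
    exact (mul_nonpos_of_nonneg_of_nonpos (by positivity) (sub_nonpos.2 hle)).trans (by positivity)
  · have h := add_rpow_div_add_rpow_le hp.le hb hpos hd (sub_nonneg.2 hdc)
    rw [add_sub_cancel, add_sub_cancel] at h
    rw [abs_of_nonneg (sub_nonneg.2 hdc), mul_comm, ← le_div_iff₀ (by positivity)]
    linarith

lemma weakIntegrand_piconeTest_le {E : Type*} (hp : 1 < p) {k ε : ℝ} (hk : 0 ≤ k) (hε : 0 < ε)
    {u v : E → ℝ} {z : E × E} (h₁ : 0 ≤ u z.1) (h₂ : 0 ≤ u z.2) :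
    weakIntegrand p u (piconeTest p k ε u v) z ≤ |increment v z| ^ p := by
  have hmin (x : E) : 0 ≤ min |v x| k := le_min (abs_nonneg _) hk
  calc weakIntegrand p u (piconeTest p k ε u v) z
      ≤ |min |v z.1| k - min |v z.2| k| ^ p := by
        simpa only [weakIntegrand, piconeTest, increment, abs_of_nonneg h₁, abs_of_nonneg h₂,
          add_sub_add_right_eq_sub] using picone_inequality hp
            (add_pos_of_nonneg_of_pos h₁ hε) (add_pos_of_nonneg_of_pos h₂ hε) (hmin z.1) (hmin z.2)
    _ ≤ |increment v z| ^ p := by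
        refine Real.rpow_le_rpow (abs_nonneg _) ?_ (one_pos.trans hp).le
        simpa only [NNReal.coe_one, one_mul] using!
          (lipschitzWith_abs.min_const k).dist_le_mul (v z.1) (v z.2)

/-! ### Strict positivity of nonnegative eigenfunctions -/

lemma rpow_mul_piconeTest {E : Type*} (p : ℝ) {k ε : ℝ} (hε : 0 ≤ ε) (u v : E → ℝ) (x : E) :
    ε ^ (p - 1) * piconeTest p k ε u v x = min |v x| k ^ p * (ε / (|u x| + ε)) ^ (p - 1) := by
  rw [piconeTest, Real.div_rpow hε (by positivity)]
  ring

lemma abs_rpow_mul_piconeTest_le {E : Type*} (hp : 1 ≤ p) {k ε : ℝ} (hk : 0 ≤ k) (hε : 0 < ε)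
    (u v : E → ℝ) (x : E) : |ε ^ (p - 1) * piconeTest p k ε u v x| ≤ min |v x| k ^ p := by
  have : 0 ≤ min |v x| k := le_min (abs_nonneg _) hk
  rw [rpow_mul_piconeTest p hε.le, abs_of_nonneg (by positivity)]
  refine mul_le_of_le_one_right (by positivity)
    (Real.rpow_le_one (by positivity) ?_ (sub_nonneg.2 hp))
  exact div_le_one_of_le₀ (by simp) (by positivity)

lemma tendsto_rpow_mul_piconeTest {E : Type*} (hp : 1 < p) (k : ℝ) (u v : E → ℝ) (x : E) :
    Tendsto (fun ε => ε ^ (p - 1) * piconeTest p k ε u v x) (𝓝[>] 0)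
      (𝓝 ({x | u x = 0}.indicator (fun x => min |v x| k ^ p) x)) := by
  have hp1 : 0 < p - 1 := sub_pos.2 hp
  have heq : (fun ε : ℝ => min |v x| k ^ p * (ε / (|u x| + ε)) ^ (p - 1)) =ᶠ[𝓝[>] 0]
      fun ε => ε ^ (p - 1) * piconeTest p k ε u v x :=
    eventually_mem_nhdsWithin.mono fun ε hε => (rpow_mul_piconeTest p (le_of_lt hε) u v x).symm
  refine Tendsto.congr' heq ?_
  by_cases hx : u x = 0
  · rw [Set.indicator_of_mem (by exact hx)]
    refine tendsto_const_nhds.congr' (eventually_mem_nhdsWithin.mono fun ε hε => ?_)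
    simp [hx, (Set.mem_Ioi.1 hε).ne']
  · rw [Set.indicator_of_notMem (by exact hx)]
    have hcont : ContinuousAt
        (fun ε : ℝ => min |v x| k ^ p * (ε / (|u x| + ε)) ^ (p - 1)) 0 := by
      refine continuousAt_const.mul (ContinuousAt.rpow_const ?_ (.inr hp1.le))
      exact continuousAt_id.div (by fun_prop) (by simpa using hx)
    simpa [Real.zero_rpow hp1.ne'] using hcont.tendsto.mono_left nhdsWithin_le_nhds

lemma tendsto_rpow_mul_weakIntegrand_piconeTest {E : Type*} (hp : 1 < p) (k : ℝ) (u v : E → ℝ)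
    (z : E × E) :
    Tendsto (fun ε => ε ^ (p - 1) * weakIntegrand p u (piconeTest p k ε u v) z) (𝓝[>] 0)
      (𝓝 (weakIntegrand p u ({x | u x = 0}.indicator fun x => min |v x| k ^ p) z)) := by
  have htest (x : E) := tendsto_rpow_mul_piconeTest hp k u v x
  refine (((htest z.1).sub (htest z.2)).const_mul
    (|increment u z| ^ (p - 2) * increment u z)).congr fun ε => ?_
  simp only [weakIntegrand, increment]
  ring

lemma IsEigenfunction.tendsto_rpow_mul_weakForm_piconeTest (hs0 : 0 < s) (hs1 : s < 1)
    (hp : 1 < p) (hu : IsEigenfunction s p w lam u) (hv : MemD s p v) {k : ℝ} (hk : 0 ≤ k) :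
    Tendsto (fun ε => ε ^ (p - 1) * weakForm s p u (piconeTest p k ε u v)) (𝓝[>] 0) (𝓝 0) := by
  obtain ⟨huD, -, hweak⟩ := hu
  set g : RN N → ℝ := fun x => w x * |u x| ^ (p - 2) * u x
  have hdom : Integrable fun x => g x * min |v x| k ^ p := by
    obtain ⟨K, hK⟩ := exists_lipschitzWith_min_abs_rpow hp.le hk
    exact (hweak _ (hv.comp hs0 hs1 hp.le hK (by simp [hk, (one_pos.trans hp).ne']))).1
  have hlim : Tendsto (fun ε => ∫ x, g x * (ε ^ (p - 1) * piconeTest p k ε u v x)) (𝓝[>] 0)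
      (𝓝 (∫ x, g x * {x | u x = 0}.indicator (fun x => min |v x| k ^ p) x)) := by
    refine tendsto_integral_filter_of_dominated_convergence _ ?_ ?_ hdom.norm
      (.of_forall fun x => (tendsto_rpow_mul_piconeTest hp k u v x).const_mul (g x))
    · filter_upwards [eventually_mem_nhdsWithin] with ε hε
      have hint := (hweak _ (memD_piconeTest hs0 hs1 hp.le huD hv hk hε)).1
      exact (hint.mul_const (ε ^ (p - 1))).1.congr (.of_forall fun x => by simp only [g]; ring)
    · filter_upwards [eventually_mem_nhdsWithin] with ε hε
      refine .of_forall fun x => ?_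
      simp only [norm_mul (g x)]
      gcongr
      exact (abs_rpow_mul_piconeTest_le hp.le hk hε u v x).trans (le_abs_self _)
  have hzero (x : RN N) : g x * {x | u x = 0}.indicator (fun x => min |v x| k ^ p) x = 0 := by
    by_cases hx : u x = 0 <;> simp [g, hx]
  simp only [hzero, integral_zero] at hlim
  have hlim' := hlim.const_mul lam
  rw [mul_zero] at hlim'
  refine hlim'.congr' (eventually_mem_nhdsWithin.mono fun ε hε => ?_)
  dsimp only
  rw [(hweak _ (memD_piconeTest hs0 hs1 hp.le huD hv hk hε)).2, mul_left_comm,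
    ← integral_const_mul (ε ^ (p - 1))]
  simp only [g, mul_left_comm]

lemma ae_eq_zero_of_tendsto_integral_zero {α : Type*} [MeasurableSpace α] {μ : Measure α}
    {F : ℕ → α → ℝ} {f : α → ℝ} (hFi : ∀ n, Integrable (F n) μ) (hF0 : ∀ n, 0 ≤ᵐ[μ] F n)
    (hlim : ∀ᵐ x ∂μ, Tendsto (fun n => F n x) atTop (𝓝 (f x)))
    (hint : Tendsto (fun n => ∫ x, F n x ∂μ) atTop (𝓝 0)) : f =ᵐ[μ] 0 := by
  have hL1 : Tendsto (fun n => eLpNorm (F n - 0) 1 μ) atTop (𝓝 0) := by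
    have h (n : ℕ) : eLpNorm (F n - 0) 1 μ = ENNReal.ofReal (∫ x, F n x ∂μ) := by
      rw [sub_zero, eLpNorm_one_eq_lintegral_enorm,
        ofReal_integral_eq_lintegral_ofReal (hFi n) (hF0 n)]
      refine lintegral_congr_ae ((hF0 n).mono fun x hx => Real.enorm_eq_ofReal hx)
    simpa only [h, ENNReal.ofReal_zero] using ENNReal.tendsto_ofReal hint
  obtain ⟨ns, hns, hsub⟩ := (tendstoInMeasure_of_tendsto_eLpNorm one_ne_zero
    (fun n => (hFi n).1) aestronglyMeasurable_zero hL1).exists_seq_tendsto_ae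
  filter_upwards [hlim, hsub] with x hx hx'
  exact tendsto_nhds_unique (hx.comp hns.tendsto_atTop) hx'

-- Multiply Picone's inequality by `ε ^ (p - 1)` and let `ε → 0`: the right-hand side disappears,
-- and by the weak equation so does the integral of the left-hand side.
lemma IsEigenfunction.ae_weakIntegrand_indicator_eq_zero (hs0 : 0 < s) (hs1 : s < 1)
    (hp : 1 < p) (hu : IsEigenfunction s p w lam u) (hnn : ∀ᵐ x, 0 ≤ u x) (hv : MemD s p v)
    {k : ℝ} (hk : 0 ≤ k) : ∀ᵐ z ∂gagliardoMeasure N s p,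
      weakIntegrand p u ({x | u x = 0}.indicator fun x => min |v x| k ^ p) z = 0 := by
  have hp0 : 0 < p := one_pos.trans hp
  set ε : ℕ → ℝ := fun n => 1 / ((n : ℝ) + 1)
  have hε0 (n : ℕ) : 0 < ε n := Nat.one_div_pos_of_nat
  have hε : Tendsto ε atTop (𝓝[>] 0) :=
    tendsto_nhdsWithin_iff.2 ⟨tendsto_one_div_add_atTop_nhds_zero_nat, .of_forall hε0⟩
  have hεp : Tendsto (fun n => ε n ^ (p - 1)) atTop (𝓝 0) := by
    have := (tendsto_nhds_of_tendsto_nhdsWithin hε).rpow_const (.inr (sub_nonneg.2 hp.le))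
    rwa [Real.zero_rpow (sub_ne_zero.2 hp.ne')] at this
  have hdv := hv.memLp_increment hs0 hs1 hp0
  have hVi (n : ℕ) : Integrable (weakIntegrand p u (piconeTest p k (ε n) u v))
      (gagliardoMeasure N s p) :=
    integrable_weakIntegrand hp (hu.1.memLp_increment hs0 hs1 hp0)
      ((memD_piconeTest hs0 hs1 hp.le hu.1 hv hk (hε0 n)).memLp_increment hs0 hs1 hp0)
  have hdvi := integrable_abs_increment_rpow hp0 hdv
  set F : ℕ → RN N × RN N → ℝ := fun n z => ε n ^ (p - 1) *
    (|increment v z| ^ p - weakIntegrand p u (piconeTest p k (ε n) u v) z)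
  have hF0 (n : ℕ) : 0 ≤ᵐ[gagliardoMeasure N s p] F n := by
    filter_upwards [ae_gagliardoMeasure_of_ae hnn] with z hz
    exact mul_nonneg (Real.rpow_nonneg (hε0 n).le _)
      (sub_nonneg.2 (weakIntegrand_piconeTest_le hp hk (hε0 n) hz.1 hz.2))
  have hlim (z : RN N × RN N) : Tendsto (fun n => F n z) atTop
      (𝓝 (-weakIntegrand p u ({x | u x = 0}.indicator fun x => min |v x| k ^ p) z)) := by
    have h := (hεp.mul_const (|increment v z| ^ p)).sub
      ((tendsto_rpow_mul_weakIntegrand_piconeTest hp k u v z).comp hε)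
    rw [zero_mul, zero_sub] at h
    exact h.congr fun n => (mul_sub _ _ _).symm
  have hint : Tendsto (fun n => ∫ z, F n z ∂gagliardoMeasure N s p) atTop (𝓝 0) := by
    have h := (hεp.mul_const (energy s p v).toReal).sub
      ((hu.tendsto_rpow_mul_weakForm_piconeTest hs0 hs1 hp hv hk).comp hε)
    rw [zero_mul, sub_zero] at h
    refine h.congr fun n => ?_
    rw [integral_const_mul, integral_sub hdvi (hVi n),
      integral_abs_increment_rpow hp0.le hv.aemeasurable, ← weakForm_eq_integral, mul_sub]
    rfl
  filter_upwards [ae_eq_zero_of_tendsto_integral_zero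
    (fun n => (hdvi.sub (hVi n)).const_mul _) hF0 (.of_forall hlim) hint] with z hz
  exact neg_eq_zero.1 hz

lemma IsEigenfunction.ae_eq_zero_of_eq_zero_of_pos (hs0 : 0 < s) (hs1 : s < 1) (hp : 1 < p)
    (hu : IsEigenfunction s p w lam u) (hnn : ∀ᵐ x, 0 ≤ u x) (hv : MemD s p v) :
    ∀ᵐ z : RN N × RN N, u z.1 = 0 → 0 < u z.2 → v z.1 = 0 := by
  filter_upwards [ae_prod_of_ae_gagliardoMeasure
    (hu.ae_weakIntegrand_indicator_eq_zero hs0 hs1 hp hnn hv zero_le_one)] with z hz hx hy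
  have hne : z.1 ≠ z.2 := fun h => hy.ne' (h ▸ hx)
  have hW := hz hne
  have hcoef : |u z.2| ^ (p - 2) ≠ 0 := (Real.rpow_pos_of_pos (abs_pos.2 hy.ne') _).ne'
  have hmin : 0 ≤ min |v z.1| 1 := le_min (abs_nonneg _) zero_le_one
  have hzero : v z.1 = 0 ∧ |v z.1| ≤ 1 := by
    simpa [weakIntegrand, increment, hx, hy.ne', hcoef,
      Real.rpow_eq_zero hmin (one_pos.trans hp).ne', min_eq_iff] using hW
  exact hzero.1

theorem IsEigenfunction.ae_pos (hs0 : 0 < s) (hs1 : s < 1) (hp : 1 < p)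
    (hu : IsEigenfunction s p w lam u) (hnn : ∀ᵐ x, 0 ≤ u x) : ∀ᵐ x, 0 < u x := by
  have on_ball (j : ℕ) : ∀ᵐ z : RN N × RN N, u z.1 = 0 → 0 < u z.2 → (j : ℝ) + 1 < ‖z.1‖ := by
    let φ : ContDiffBump (0 : RN N) := ⟨j + 1, j + 2, by positivity, by linarith⟩
    have hφ : MemD s p φ := memD_of_contDiff (one_pos.trans hp).ne' φ.contDiff φ.hasCompactSupport
    filter_upwards [hu.ae_eq_zero_of_eq_zero_of_pos hs0 hs1 hp hnn hφ] with z hz hx hy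
    by_contra! hle
    have hone := φ.one_of_mem_closedBall (mem_closedBall_zero_iff.2 hle)
    exact zero_ne_one ((hz hx hy).symm.trans hone)
  have hprod : ∀ᵐ z : RN N × RN N, u z.1 = 0 → ¬ 0 < u z.2 := by
    filter_upwards [ae_all_iff.2 on_ball] with z hz hx hy
    obtain ⟨j, hj⟩ := exists_nat_ge ‖z.1‖
    linarith [hz j hx hy]
  by_contra hpos
  have hfreq : ∃ᵐ x, u x = 0 := fun hne => hpos <| by
    filter_upwards [hne, hnn] with x hx hx0 using hx0.lt_of_ne' hx
  obtain ⟨x, hx0, hx⟩ := (hfreq.and_eventually (Measure.ae_ae_of_ae_prod hprod)).exists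
  refine hu.2.1 ?_
  filter_upwards [hx, hnn] with y hy hy0 using le_antisymm (not_lt.1 (hy hx0)) hy0

/-! ### Nonnegative eigenfunctions and the first eigenvalue -/

lemma abs_rpow_sub_two_mul_mul_piconeTest {E : Type*} (hp : p ≠ 1) {k ε : ℝ} (hε : 0 ≤ ε)
    {u : E → ℝ} (v : E → ℝ) {x : E} (hx : 0 ≤ u x) :
    |u x| ^ (p - 2) * u x * piconeTest p k ε u v x =
      min |v x| k ^ p * (u x / (u x + ε)) ^ (p - 1) := by
  have h := abs_rpow_sub_two_mul_abs hp (u x)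
  rw [abs_of_nonneg hx] at h
  rw [piconeTest, abs_of_nonneg hx, h, Real.div_rpow hx (by positivity)]
  ring

lemma abs_rpow_sub_two_mul_mul_piconeTest_le {E : Type*} (hp : 1 < p) {k ε : ℝ} (hk : 0 ≤ k)
    (hε : 0 ≤ ε) {u : E → ℝ} (v : E → ℝ) {x : E} (hx : 0 ≤ u x) :
    |(|u x| ^ (p - 2) * u x * piconeTest p k ε u v x)| ≤ |v x| ^ p := by
  have hmin : 0 ≤ min |v x| k := le_min (abs_nonneg _) hk
  have hfrac : u x / (u x + ε) ≤ 1 := div_le_one_of_le₀ (by linarith) (by positivity)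
  rw [abs_rpow_sub_two_mul_mul_piconeTest hp.ne' hε v hx, abs_of_nonneg (by positivity)]
  refine (mul_le_of_le_one_right (by positivity)
    (Real.rpow_le_one (by positivity) hfrac (sub_pos.2 hp).le)).trans ?_
  exact Real.rpow_le_rpow hmin (min_le_left _ _) (one_pos.trans hp).le

lemma tendsto_abs_rpow_sub_two_mul_mul_piconeTest {E : Type*} (hp : p ≠ 1) {ε : ℕ → ℝ}
    (hε0 : ∀ n, 0 ≤ ε n) (hε : Tendsto ε atTop (𝓝 0)) {u : E → ℝ} (v : E → ℝ) {x : E}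
    (hx : 0 < u x) :
    Tendsto (fun n : ℕ => |u x| ^ (p - 2) * u x * piconeTest p n (ε n) u v x) atTop
      (𝓝 (|v x| ^ p)) := by
  have hfrac : Tendsto (fun n => u x / (u x + ε n)) atTop (𝓝 1) := by
    simpa [hx.ne', Pi.div_def] using
      (tendsto_const_nhds (x := u x)).div (hε.const_add (u x)) (by simpa using hx.ne')
  have hlim := (hfrac.rpow_const (p := p - 1) (.inl one_ne_zero)).const_mul (|v x| ^ p)
  rw [Real.one_rpow, mul_one] at hlim
  refine hlim.congr' ?_
  obtain ⟨m, hm⟩ := exists_nat_ge |v x|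
  filter_upwards [eventually_ge_atTop m] with n hn
  rw [abs_rpow_sub_two_mul_mul_piconeTest hp (hε0 n) v hx.le,
    min_eq_left (hm.trans (Nat.cast_le.2 hn))]

lemma IsEigenfunction.mul_integral_piconeTest_le (hs0 : 0 < s) (hs1 : s < 1) (hp : 1 < p)
    (hu : IsEigenfunction s p w lam u) (hnn : ∀ᵐ x, 0 ≤ u x) (hv : MemD s p v) {k ε : ℝ}
    (hk : 0 ≤ k) (hε : 0 < ε) :
    lam * ∫ x, w x * |u x| ^ (p - 2) * u x * piconeTest p k ε u v x ≤ (energy s p v).toReal := by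
  have hp0 : 0 < p := one_pos.trans hp
  have htest := memD_piconeTest hs0 hs1 hp.le hu.1 hv hk hε
  rw [← (hu.2.2 _ htest).2, weakForm_eq_integral,
    ← integral_abs_increment_rpow hp0.le hv.aemeasurable]
  refine integral_mono_ae (integrable_weakIntegrand hp (hu.1.memLp_increment hs0 hs1 hp0)
    (htest.memLp_increment hs0 hs1 hp0))
    (integrable_abs_increment_rpow hp0 (hv.memLp_increment hs0 hs1 hp0)) ?_
  filter_upwards [ae_gagliardoMeasure_of_ae hnn] with z hz
  exact weakIntegrand_piconeTest_le hp hk hε hz.1 hz.2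

theorem IsEigenfunction.mul_integral_le_energy (hs0 : 0 < s) (hs1 : s < 1) (hp : 1 < p)
    (hu : IsEigenfunction s p w lam u) (hpos : ∀ᵐ x, 0 < u x) (hv : MemD s p v)
    (hint : Integrable fun x => w x * |v x| ^ p) :
    lam * ∫ x, w x * |v x| ^ p ≤ (energy s p v).toReal := by
  set ε : ℕ → ℝ := fun n => 1 / ((n : ℝ) + 1)
  have hε0 (n : ℕ) : 0 < ε n := Nat.one_div_pos_of_nat
  have hlim : Tendsto (fun n : ℕ => ∫ x, w x * |u x| ^ (p - 2) * u x * piconeTest p n (ε n) u v x)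
      atTop (𝓝 (∫ x, w x * |v x| ^ p)) := by
    refine tendsto_integral_of_dominated_convergence _ (fun n => (hu.2.2 _
      (memD_piconeTest hs0 hs1 hp.le hu.1 hv n.cast_nonneg (hε0 n))).1.1) hint.norm ?_ ?_
    · intro n
      filter_upwards [hpos] with x hx
      rw [mul_assoc (w x), mul_assoc (w x), norm_mul (w x), norm_mul (w x),
        Real.norm_of_nonneg (Real.rpow_nonneg (abs_nonneg (v x)) p)]
      gcongr
      exact abs_rpow_sub_two_mul_mul_piconeTest_le hp n.cast_nonneg (hε0 n).le v hx.le
    · filter_upwards [hpos] with x hx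
      simpa only [mul_assoc] using (tendsto_abs_rpow_sub_two_mul_mul_piconeTest hp.ne'
        (fun n => (hε0 n).le) tendsto_one_div_add_atTop_nhds_zero_nat v hx).const_mul (w x)
  exact le_of_tendsto' (hlim.const_mul lam) fun n =>
    hu.mul_integral_piconeTest_le hs0 hs1 hp (hpos.mono fun x => le_of_lt) hv n.cast_nonneg (hε0 n)

lemma IsEigenfunction.neg (hs0 : 0 < s) (hs1 : s < 1) (hp : 1 ≤ p)
    (hu : IsEigenfunction s p w lam u) : IsEigenfunction s p w lam fun x => -u x := by
  obtain ⟨huD, hu0, hweak⟩ := hu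
  refine ⟨by simpa using huD.const_mul hs0 hs1 hp (-1), by simpa using hu0, fun v hv => ?_⟩
  have hrhs : (fun x => w x * |-u x| ^ (p - 2) * -u x * v x) =
      fun x => -(w x * |u x| ^ (p - 2) * u x * v x) := by
    ext x
    rw [abs_neg]
    ring
  have hlhs : weakForm s p (fun x => -u x) v = -weakForm s p u v := by
    simp only [weakForm_eq_integral, ← integral_neg, weakIntegrand, increment, ← neg_sub', abs_neg,
      mul_neg, neg_mul]
  rw [hrhs, hlhs, integral_neg, (hweak v hv).2, mul_neg]
  exact ⟨(hweak v hv).1.neg, rfl⟩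

lemma MemD.exists_integral_eq_one (hs0 : 0 < s) (hs1 : s < 1) (hp : 1 ≤ p) (hu : MemD s p u)
    (hint : Integrable fun x => w x * |u x| ^ p) (hpos : 0 < ∫ x, w x * |u x| ^ p) :
    ∃ v, MemD s p v ∧ (Integrable fun x => w x * |v x| ^ p) ∧ ∫ x, w x * |v x| ^ p = 1 ∧
      (energy s p v).toReal = (∫ x, w x * |u x| ^ p)⁻¹ * (energy s p u).toReal := by
  set I : ℝ := ∫ x, w x * |u x| ^ p
  set c : ℝ := I⁻¹ ^ p⁻¹
  have hp0 : 0 < p := one_pos.trans_le hp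
  have hc : 0 ≤ c := by positivity
  have hcp : c ^ p = I⁻¹ := Real.rpow_inv_rpow (by positivity) hp0.ne'
  have hfun : (fun x => w x * |c * u x| ^ p) = fun x => I⁻¹ * (w x * |u x| ^ p) := by
    ext x
    rw [abs_mul, abs_of_nonneg hc, Real.mul_rpow hc (abs_nonneg _), hcp]
    ring
  refine ⟨fun x => c * u x, hu.const_mul hs0 hs1 hp c, ?_, ?_, ?_⟩
  · simpa only [hfun] using hint.const_mul I⁻¹
  · rw [hfun, integral_const_mul, inv_mul_cancel₀ hpos.ne']
  · rw [energy_const_mul hp0.le, abs_of_nonneg hc, hcp, ENNReal.toReal_mul,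
      ENNReal.toReal_ofReal (by positivity)]

lemma IsEigenfunction.integrable_and_energy_eq (hp : 0 < p) (hu : IsEigenfunction s p w lam u) :
    (Integrable fun x => w x * |u x| ^ p) ∧
      (energy s p u).toReal = lam * ∫ x, w x * |u x| ^ p := by
  have h := hu.2.2 u hu.1
  simp only [mul_assoc (w _), abs_rpow_sub_two_mul_mul_self hp.ne'] at h
  rwa [weakForm_self hp hu.1.aemeasurable] at h

theorem IsEigenfunction.eq_firstEigenvalue_of_nonneg (hs0 : 0 < s) (hs1 : s < 1) (hp : 1 < p)
    (hsp : s * p < N) (hlam : 0 ≤ lam) (hu : IsEigenfunction s p w lam u)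
    (hnn : ∀ᵐ x, 0 ≤ u x) : lam = firstEigenvalue s p w := by
  have hp0 : 0 < p := one_pos.trans hp
  have hpos := hu.ae_pos hs0 hs1 hp hnn
  obtain ⟨hint, henergy⟩ := hu.integrable_and_energy_eq hp0
  have henergy_pos : 0 < (energy s p u).toReal := ENNReal.toReal_pos
    (fun h => hu.2.1 (hu.1.ae_eq_zero_of_energy_eq_zero hs0 hs1 hp.le hsp h))
    (hu.1.energy_ne_top hs0 hs1 hp0)
  have hint_pos : 0 < ∫ x, w x * |u x| ^ p := pos_of_mul_pos_right (henergy ▸ henergy_pos) hlam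
  refine (IsLeast.csInf_eq ⟨?_, ?_⟩).symm
  · obtain ⟨v, hv, hvi, hv1, hve⟩ := hu.1.exists_integral_eq_one hs0 hs1 hp.le hint hint_pos
    refine ⟨v, hv, hvi, hv1, ?_⟩
    rw [hve, henergy, mul_left_comm, inv_mul_cancel₀ hint_pos.ne', mul_one]
  · rintro t ⟨v, hv, hvi, hv1, rfl⟩
    simpa only [hv1, mul_one] using hu.mul_integral_le_energy hs0 hs1 hp hpos hv hvi

end FracHardy

theorem mainTheorem8_general {N : ℕ} {s p : ℝ} (hs0 : 0 < s) (hs1 : s < 1) (hp : 1 < p)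
    (hsp : s * p < N) {w : FracHardy.RN N → ℝ} {lam : ℝ} (hlam_nonneg : 0 ≤ lam)
    (hlam : lam ≠ FracHardy.firstEigenvalue s p w) {u : FracHardy.RN N → ℝ}
    (hu : FracHardy.IsEigenfunction s p w lam u) : FracHardy.ChangesSign u := by
  constructor
  · refine pos_iff_ne_zero.2 fun hnull => hlam ?_
    refine (hu.neg hs0 hs1 hp.le).eq_firstEigenvalue_of_nonneg hs0 hs1 hp hsp hlam_nonneg ?_
    filter_upwards [measure_eq_zero_iff_ae_notMem.1 hnull] with x hx
    exact neg_nonneg.2 (not_lt.1 hx)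
  · refine pos_iff_ne_zero.2 fun hnull => hlam ?_
    refine hu.eq_firstEigenvalue_of_nonneg hs0 hs1 hp hsp hlam_nonneg ?_
    filter_upwards [measure_eq_zero_iff_ae_notMem.1 hnull] with x hx
    exact not_lt.1 hx

theorem mainTheorem8 (N : ℕ) (s p : ℝ) (hs0 : 0 < s) (hs1 : s < 1) (hp : 1 < p)
    (hsp : s * p < (N : ℝ))
    (w₁ w₂ : FracHardy.RN N → ℝ)
    (hw₁ : FracHardy.MemHardyZero s p w₁) (hw₁_nonneg : ∀ᵐ x, 0 ≤ w₁ x)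
    (hw₂ : LocallyIntegrable w₂) (hw₂_nonneg : ∀ᵐ x, 0 ≤ w₂ x)
    (lam : ℝ) (hlam_nonneg : 0 ≤ lam)
    (hlam : lam ≠ FracHardy.firstEigenvalue s p (fun x => w₁ x - w₂ x))
    (u : FracHardy.RN N → ℝ)
    (hu : FracHardy.IsEigenfunction s p (fun x => w₁ x - w₂ x) lam u) :
    FracHardy.ChangesSign u :=
  mainTheorem8_general hs0 hs1 hp hsp hlam_nonneg hlam hu
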